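/- There is a universal constant $C_0\ge 1$ such that the following holds. Let $\mathcal X$ be a measurable space, $\mu$ a probability measure on $\mathcal X$, and $\mathcal F$ a nonempty class of measurable functions $f:\mathcal X\to[0,1]$ for which the suprema over $f\in\mathcal F$ of $\sum_{i\le n}(a_if(z_i)+b_if(z_i)^2)$ are universally measurable functions of $(z_1,\dots,z_n)\in\mathcal X^n$, for all $n$ and all $a,b\in\mathbb R^n$. For $m\in\mathbb N$ and $Z_1,\dots,Z_m\in\mathcal X$ let $$W_{m,Z}(\mathcal F)=\mathbb E_\xi\Big[\exp\Big(\sup_{f\in\mathcal F}\sum_{i=1}^m \xi_i f(Z_i)-\tfrac12 f(Z_i)^2\Big)\Big],\qquad \xi_1,\dots,\xi_m\ \text{i.i.d. standard Gaussian},$$ be the Wills functional, and let $\mathbb E_\mu[W_m(\mathcal F)]$ be its expectation over i.i.d. points $Z_1,\dots,Z_m\sim\mu$. Let $T\ge1$ be an integer and $\sigma>0$. On a probability space with a filtration $(\mathcal H_t)_{t\ge0}$, let $x_1,\dots,x_T$ be an adapted $\mathcal X$-valued process that is $\sigma$-smooth with respect to $\mu$: for each $t\in\{1,\dots,T\}$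 the conditional law of $x_t$ given $\mathcal H_{t-1}$ is an $\mathcal H_{t-1}$-measurable random probability measure $\mu_t$ which almost surely satisfies $\mu_t\ll\mu$ and $\|d\mu_t/d\mu\|_{L^\infty(\mu)}\le 1/\sigma$. Let $x'_1,\dots,x'_T$ be a tangent sequence: for each $t$, conditionally on $\mathcal H_{t-1}$ and $x'_1,\dots,x'_{t-1}$, the variables $x_t$ and $x'_t$ are independent with common law $\mu_t$. Then for every stopping time $\tau\le T$ of $(\mathcal H_t)$ (in particular for $\tau=T$), every $c>0$ and every $\delta\in(0,1/2]$, with probability at least $1-\delta$, $$\sup_{f\in\mathcal F}\sum_{t=1}^{\tau}\big(f(x'_t)-(1+2c)f(x_t)\big)\le C_0\,\frac{(1+c)^2}{c}\Big(\ln\mathbb E_\mu\Big[W_{\lfloor 2T\ln(T/\delta)/\sigma\rfloor}\Big(\tfrac{c}{1+c}\mathcal F\Big)\Big]+\frac1c\ln\frac1\delta\Big),$$ where $a\mathcal F=\{af:f\in\mathcal F\}$. -/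

import Mathlib

open MeasureTheory ProbabilityTheory
open scoped Pointwise

noncomputable section

/-- The Wills functional of the class `F` on the points `Z 0, …, Z (m - 1)`:
the expectation, over a standard Gaussian vector `ξ`, of
`exp (sup_{f ∈ F} ∑ i, (ξ i * f (Z i) - f (Z i) ^ 2 / 2))`. -/
def willsFunctional {X : Type*} (F : Set (X → ℝ)) {m : ℕ} (Z : Fin m → X) : ℝ :=
  ∫ ξ : Fin m → ℝ,
    Real.exp (⨆ f : F, ∑ i, (ξ i * (f : X → ℝ) (Z i) - (f : X → ℝ) (Z i) ^ 2 / 2))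
    ∂(Measure.pi fun _ : Fin m => gaussianReal 0 1)

/-- The expected Wills functional of `F` on `m` i.i.d. points with law `μ`. -/
def expectedWills {X : Type*} [MeasurableSpace X] (μ : Measure X) (F : Set (X → ℝ)) (m : ℕ) : ℝ :=
  ∫ Z : Fin m → X, willsFunctional F Z ∂(Measure.pi fun _ : Fin m => μ)

/-- The measure `p` is `σ`-smooth with respect to `μ`: it has a density with respect to `μ` whose
essential supremum is at most `1 / σ`. -/
def IsSmooth {X : Type*} [MeasurableSpace X] (σ : ℝ) (p μ : Measure X) : Prop :=
  p ≪ μ ∧ essSup (p.rnDeriv μ) μ ≤ ENNReal.ofReal (1 / σ)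

/-- The process `x 1, …, x T` is `σ`-smooth with respect to `μ`, for the history `H`: it is adapted,
and for each `t < T` there is an `H t`-measurable random probability measure `ν`, almost surely
`σ`-smooth with respect to `μ`, that is the conditional law of `x (t + 1)` given `H t`. -/
structure IsSmoothProcess {Ω X : Type*} {mΩ : MeasurableSpace Ω} [mX : MeasurableSpace X]
    (P : Measure Ω) (H : Filtration ℕ mΩ) (x : ℕ → Ω → X) (T : ℕ) (σ : ℝ) (μ : Measure X) :
    Prop where
  adapted : ∀ t < T, Measurable[H (t + 1)] (x (t + 1))
  smooth : ∀ t < T, ∃ ν : @Kernel Ω X (H t) mX, IsMarkovKernel ν ∧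
    (∀ᵐ ω ∂P, IsSmooth σ (ν ω) μ) ∧
    ∀ A : Set X, MeasurableSet A →
      P⟦x (t + 1) ⁻¹' A | H t⟧ =ᵐ[P] fun ω => (ν ω).real A

/-- The history up to time `t`, together with `x' 1, …, x' t`. -/
abbrev jointHistory {Ω X : Type*} {mΩ : MeasurableSpace Ω} [mX : MeasurableSpace X]
    (H : Filtration ℕ mΩ) (x' : ℕ → Ω → X) (t : ℕ) : MeasurableSpace Ω :=
  H t ⊔ ⨆ s ∈ Set.Icc 1 t, mX.comap (x' s)

/-- `x' 1, …, x' T` is a tangent sequence to `x 1, …, x T`: given the history `H t`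
(and the variables `x' 1, …, x' t` already drawn), `x (t + 1)` and `x' (t + 1)` are independent, and
both have the conditional law of `x (t + 1)` given `H t`. -/
structure IsTangent {Ω X : Type*} {mΩ : MeasurableSpace Ω} [MeasurableSpace X]
    (P : Measure Ω) (H : Filtration ℕ mΩ) (x x' : ℕ → Ω → X) (T : ℕ) : Prop where
  measurable : ∀ t < T, Measurable (x' (t + 1))
  cond_iid : ∀ t < T, ∀ A B : Set X, MeasurableSet A → MeasurableSet B →
    P⟦x (t + 1) ⁻¹' A ∩ x' (t + 1) ⁻¹' B | jointHistory H x' t⟧ =ᵐ[P]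
      fun ω => (P⟦x (t + 1) ⁻¹' A | H t⟧) ω * (P⟦x (t + 1) ⁻¹' B | H t⟧) ω

/-- The usual measurability requirement on a class `F` of functions that may be uncountable: the
suprema over `F` of `∑ i, (a i * f (z i) + b i * f (z i) ^ 2)` are universally measurable functions
of the points `z`, that is, measurable for the completion of every probability measure. -/
def HasMeasurableSuprema {X : Type*} [MeasurableSpace X] (F : Set (X → ℝ)) : Prop :=
  ∀ (n : ℕ) (a b : Fin n → ℝ) (Q : Measure (Fin n → X)), IsProbabilityMeasure Q →
    AEMeasurable (fun z : Fin n → X =>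
      ⨆ f : F, ∑ i, (a i * (f : X → ℝ) (z i) + b i * (f : X → ℝ) (z i) ^ 2)) Q

end

/-! The proof bounds an exponential moment. For a suitable `l > 0` and `c' ≤ c`, let `v_t(f)` be `l`
times the stopped sum of `f(x'_s) - (1 + 2c') f(x_s)` over `s ≤ t`. It suffices to bound the
expectation of `exp (sup_f v_T(f))` by four times the expected Wills functional of `a F`, with `a =
c / (1 + c)`, and then apply Markov's inequality. Rounds are traded, last one first, for blocks of
`k` fresh points from `μ`; the intermediate quantity is `shiftedWills`, a Wills functional whose
exponent also carries `v_t`.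

One round (`lintegral_shiftedWills_step`) combines four facts. Convexity: the increment is the
average of `2l f(x')` and `-2l(1 + 2c') f(x)`, so the two points separate and each may be replaced
by a point `z` of the common conditional law. Offset: since `2l(1 + c') = a E|ξ|`, these terms are
`± a E|ξ| f(z) - 2lc' f(z)`; as `f² ≤ f` and `a²/2 ≤ 2lc'`, the negative drift pays for the Wills
penalty `a² f(z)²/2`. Symmetrization: by Jensen `E|ξ|` may be replaced by `|ξ|`, and the two signs
together give `ξ`, which is exactly a Wills increment at `z` (`add_shiftedWills_le_lintegral_gain`).
Rejection sampling: smoothness means `σ ν ≤ μ`, and additional Wills increments never decrease the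
functional, so `k` points from `μ` dominate one from `ν` up to the factor `1 - (1 - σ)^k`
(`lintegral_smooth_le_shiftedWills`). With `k = ⌊2 log(T/δ)/σ⌋`, the product of these factors over
`T` rounds is at least `1/4`. -/

noncomputable section

open scoped ENNReal

/-! ### Exponents built from point evaluations -/

/-- The exponential of the supremum of `v` over the class `F`, in `[0, ∞]`. -/
def supExp {X : Type*} (F : Set (X → ℝ)) (v : F → ℝ) : ℝ≥0∞ :=
  ⨆ f, ENNReal.ofReal (Real.exp (v f))

/-- A family of functionals on `F` that are measurably parametrized combinations of point
evaluations of `f` and `f ^ 2`. -/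
def IsForm {X : Type*} [MeasurableSpace X] (F : Set (X → ℝ)) {S : Type*} [MeasurableSpace S]
    (v : S → F → ℝ) : Prop :=
  ∃ (n : ℕ) (a b : S → Fin n → ℝ) (z : S → Fin n → X),
    Measurable a ∧ Measurable b ∧ Measurable z ∧
    ∀ s f, v s f = ∑ i, (a s i * (f : X → ℝ) (z s i) + b s i * (f : X → ℝ) (z s i) ^ 2)

namespace IsForm

variable {X : Type*} [MeasurableSpace X] {F : Set (X → ℝ)}
  {S : Type*} [MeasurableSpace S] {S' : Type*} [MeasurableSpace S']

theorem comp {v : S → F → ℝ} (hv : IsForm F v) {φ : S' → S} (hφ : Measurable φ) :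
    IsForm F (fun s => v (φ s)) := by
  obtain ⟨n, a, b, z, ha, hb, hz, h⟩ := hv
  exact ⟨n, fun s => a (φ s), fun s => b (φ s), fun s => z (φ s), ha.comp hφ, hb.comp hφ,
    hz.comp hφ, fun s f => h (φ s) f⟩

theorem const {v : S → F → ℝ} (hv : IsForm F v) (s : S) : IsForm F (fun _ : S' => v s) :=
  hv.comp measurable_const

theorem add {v w : S → F → ℝ} (hv : IsForm F v) (hw : IsForm F w) :
    IsForm F (fun s => v s + w s) := by
  obtain ⟨n, a, b, z, ha, hb, hz, h⟩ := hv
  obtain ⟨n', a', b', z', ha', hb', hz', h'⟩ := hw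
  refine ⟨n + n', fun s => Fin.append (a s) (a' s), fun s => Fin.append (b s) (b' s),
    fun s => Fin.append (z s) (z' s), ?_, ?_, ?_, ?_⟩
  · refine measurable_pi_iff.2 fun i => ?_
    refine Fin.addCases (fun j => ?_) (fun j => ?_) i
    · simpa using measurable_pi_iff.1 ha j
    · simpa using measurable_pi_iff.1 ha' j
  · refine measurable_pi_iff.2 fun i => ?_
    refine Fin.addCases (fun j => ?_) (fun j => ?_) i
    · simpa using measurable_pi_iff.1 hb j
    · simpa using measurable_pi_iff.1 hb' j
  · refine measurable_pi_iff.2 fun i => ?_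
    refine Fin.addCases (fun j => ?_) (fun j => ?_) i
    · simpa using measurable_pi_iff.1 hz j
    · simpa using measurable_pi_iff.1 hz' j
  · intro s f
    simp [Fin.sum_univ_add, h, h']

theorem smul {v : S → F → ℝ} (hv : IsForm F v) {r : S → ℝ} (hr : Measurable r) :
    IsForm F (fun s => r s • v s) := by
  obtain ⟨n, a, b, z, ha, hb, hz, h⟩ := hv
  refine ⟨n, fun s i => r s * a s i, fun s i => r s * b s i, z,
    measurable_pi_iff.2 fun i => hr.mul (measurable_pi_iff.1 ha i),
    measurable_pi_iff.2 fun i => hr.mul (measurable_pi_iff.1 hb i), hz, fun s f => ?_⟩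
  simp only [Pi.smul_apply, smul_eq_mul, h, Finset.mul_sum]
  exact Finset.sum_congr rfl fun i _ => by ring

theorem zero : IsForm F (fun _ : S => (0 : F → ℝ)) :=
  ⟨0, fun _ => Fin.elim0, fun _ => Fin.elim0, fun _ => Fin.elim0,
    measurable_pi_iff.2 fun i => i.elim0, measurable_pi_iff.2 fun i => i.elim0,
    measurable_pi_iff.2 fun i => i.elim0, fun s f => by simp⟩

theorem sum {ι : Type*} (s : Finset ι) {v : ι → S → F → ℝ} (hv : ∀ i ∈ s, IsForm F (v i)) :
    IsForm F (fun ω => ∑ i ∈ s, v i ω) := by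
  classical
  induction s using Finset.induction_on with
  | empty => simpa using zero
  | insert i s hi ih =>
    simp only [Finset.sum_insert hi]
    exact (hv i (Finset.mem_insert_self i s)).add
      (ih fun j hj => hv j (Finset.mem_insert_of_mem hj))

theorem single {a b : S → ℝ} {z : S → X} (ha : Measurable a) (hb : Measurable b)
    (hz : Measurable z) :
    IsForm F (fun s f => a s * (f : X → ℝ) (z s) + b s * (f : X → ℝ) (z s) ^ 2) :=
  ⟨1, fun s _ => a s, fun s _ => b s, fun s _ => z s, measurable_pi_iff.2 fun _ => ha,
    measurable_pi_iff.2 fun _ => hb, measurable_pi_iff.2 fun _ => hz, fun s f => by simp⟩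

end IsForm

/-! ### Measurability of suprema with varying coefficients -/

section Measurability

variable {X : Type*} [MeasurableSpace X] {F : Set (X → ℝ)}

theorem AEMeasurable.countable_family {S C E : Type*} [MeasurableSpace S] [MeasurableSpace C]
    [MeasurableSpace E] [Countable C] [MeasurableSingletonClass C] {Q : Measure S}
    {G : C → S → E} (hG : ∀ c, AEMeasurable (G c) Q) {j : S → C} (hj : Measurable j) :
    AEMeasurable (fun s => G (j s) s) Q := by
  refine ⟨fun s => (hG (j s)).mk (G (j s)) s, ?_, ?_⟩
  · have : Measurable (fun p : C × S => (hG p.1).mk (G p.1) p.2) :=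
      measurable_from_prod_countable_right fun c => (hG c).measurable_mk
    exact this.comp (hj.prodMk measurable_id)
  · filter_upwards [ae_all_iff.2 fun c => (hG c).ae_eq_mk] with s hs
    exact hs (j s)

theorem bddAbove_form {X : Type*} {F : Set (X → ℝ)}
    (hF : ∀ f ∈ F, ∀ z, f z ∈ Set.Icc (0 : ℝ) 1) {n : ℕ} (a b : Fin n → ℝ) (z : Fin n → X) :
    BddAbove (Set.range fun f : F =>
      ∑ i, (a i * (f : X → ℝ) (z i) + b i * (f : X → ℝ) (z i) ^ 2)) := by
  refine ⟨∑ i, (|a i| + |b i|), ?_⟩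
  rintro _ ⟨f, rfl⟩
  refine Finset.sum_le_sum fun i _ => ?_
  obtain ⟨h0, h1⟩ := hF f f.2 (z i)
  have h2 : (f : X → ℝ) (z i) ^ 2 ≤ 1 := pow_le_one₀ h0 h1
  gcongr
  · exact (mul_le_mul_of_nonneg_right (le_abs_self _) h0).trans
      (mul_le_of_le_one_right (abs_nonneg _) h1)
  · exact (mul_le_mul_of_nonneg_right (le_abs_self _) (sq_nonneg _)).trans
      (mul_le_of_le_one_right (abs_nonneg _) h2)

theorem form_le_form_add {X : Type*} {F : Set (X → ℝ)}
    (hF : ∀ f ∈ F, ∀ z, f z ∈ Set.Icc (0 : ℝ) 1) {n : ℕ}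
    {a b a' b' : Fin n → ℝ} {ε : ℝ} (ha : ∀ i, |a i - a' i| ≤ ε) (hb : ∀ i, |b i - b' i| ≤ ε)
    (z : Fin n → X) [Nonempty F] :
    (⨆ f : F, ∑ i, (a i * (f : X → ℝ) (z i) + b i * (f : X → ℝ) (z i) ^ 2)) ≤
      (⨆ f : F, ∑ i, (a' i * (f : X → ℝ) (z i) + b' i * (f : X → ℝ) (z i) ^ 2)) +
        n * (2 * ε) := by
  refine ciSup_le fun f => ?_
  have h := le_ciSup (bddAbove_form hF a' b' z) f
  have : ∑ i, (a i * (f : X → ℝ) (z i) + b i * (f : X → ℝ) (z i) ^ 2) ≤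
      ∑ i, (a' i * (f : X → ℝ) (z i) + b' i * (f : X → ℝ) (z i) ^ 2) + ∑ _i : Fin n, 2 * ε := by
    rw [← Finset.sum_add_distrib]
    refine Finset.sum_le_sum fun i _ => ?_
    obtain ⟨h0, h1⟩ := hF f f.2 (z i)
    have h2 : (f : X → ℝ) (z i) ^ 2 ≤ 1 := pow_le_one₀ h0 h1
    have e1 : (a i - a' i) * (f : X → ℝ) (z i) ≤ ε :=
      (mul_le_mul_of_nonneg_right (le_abs_self _) h0).trans
        ((mul_le_of_le_one_right (abs_nonneg _) h1).trans (ha i))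
    have e2 : (b i - b' i) * (f : X → ℝ) (z i) ^ 2 ≤ ε :=
      (mul_le_mul_of_nonneg_right (le_abs_self _) (sq_nonneg _)).trans
        ((mul_le_of_le_one_right (abs_nonneg _) h2).trans (hb i))
    linarith
  simp only [Finset.sum_const, Finset.card_univ, Fintype.card_fin, nsmul_eq_mul] at this
  linarith

theorem abs_sub_floor_div_le (y : ℝ) (N : ℕ) :
    |y - ⌊((N : ℝ) + 1) * y⌋ / ((N : ℝ) + 1)| ≤ 1 / ((N : ℝ) + 1) := by
  have hN : (0 : ℝ) < (N : ℝ) + 1 := by positivity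
  have e : y - ⌊((N : ℝ) + 1) * y⌋ / ((N : ℝ) + 1) =
      (((N : ℝ) + 1) * y - ⌊((N : ℝ) + 1) * y⌋) / ((N : ℝ) + 1) := by
    field_simp
  rw [e, abs_div, abs_of_pos hN]
  gcongr
  rw [abs_of_nonneg (sub_nonneg.2 (Int.floor_le _))]
  linarith [Int.lt_floor_add_one (((N : ℝ) + 1) * y)]

/-- `HasMeasurableSuprema` covers fixed coefficients only. Rounding them to a grid of mesh `1/(N+1)`
leaves countably many coefficient vectors, which can be glued, and changes the supremum by at most
`2n/(N+1)` because `0 ≤ f ≤ 1`. -/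
theorem aemeasurable_iSup_form (hF : ∀ f ∈ F, ∀ z, f z ∈ Set.Icc (0 : ℝ) 1)
    (hne : F.Nonempty) (hS : HasMeasurableSuprema F) {S : Type*} [MeasurableSpace S]
    (Q : Measure S) [IsProbabilityMeasure Q] {n : ℕ} {a b : S → Fin n → ℝ} {z : S → Fin n → X}
    (ha : Measurable a) (hb : Measurable b) (hz : Measurable z) :
    AEMeasurable (fun s => ⨆ f : F,
      ∑ i, (a s i * (f : X → ℝ) (z s i) + b s i * (f : X → ℝ) (z s i) ^ 2)) Q := by
  have := hne.to_subtype
  let r (N : ℕ) (k : Fin n → ℤ) : Fin n → ℝ := fun i => k i / ((N : ℝ) + 1)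
  let j (N : ℕ) (s : S) : (Fin n → ℤ) × (Fin n → ℤ) :=
    (fun i => ⌊((N : ℝ) + 1) * a s i⌋, fun i => ⌊((N : ℝ) + 1) * b s i⌋)
  have hj (N : ℕ) : Measurable (j N) := by
    refine Measurable.prodMk ?_ ?_
    · exact measurable_pi_iff.2 fun i =>
        Int.measurable_floor.comp ((measurable_pi_iff.1 ha i).const_mul _)
    · exact measurable_pi_iff.2 fun i =>
        Int.measurable_floor.comp ((measurable_pi_iff.1 hb i).const_mul _)
  let G (N : ℕ) (k : (Fin n → ℤ) × (Fin n → ℤ)) (s : S) : ℝ :=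
    ⨆ f : F, ∑ i, (r N k.1 i * (f : X → ℝ) (z s i) + r N k.2 i * (f : X → ℝ) (z s i) ^ 2)
  have hG (N : ℕ) : AEMeasurable (fun s => G N (j N s) s) Q := by
    refine AEMeasurable.countable_family (fun k => ?_) (hj N)
    have := Measure.isProbabilityMeasure_map (μ := Q) hz.aemeasurable
    exact (hS n (r N k.1) (r N k.2) (Q.map z) this).comp_measurable hz
  refine aemeasurable_of_tendsto_metrizable_ae Filter.atTop hG (ae_of_all _ fun s => ?_)
  have hlim : Filter.Tendsto (fun N : ℕ => (n : ℝ) * (2 * (1 / ((N : ℝ) + 1)))) Filter.atTop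
      (nhds 0) := by
    simpa using (tendsto_one_div_add_atTop_nhds_zero_nat (𝕜 := ℝ)).const_mul 2 |>.const_mul (n : ℝ)
  refine tendsto_iff_dist_tendsto_zero.2 (squeeze_zero (fun _ => dist_nonneg) (fun N => ?_) hlim)
  rw [Real.dist_eq, abs_le]
  have ha' (i : Fin n) : |a s i - r N (j N s).1 i| ≤ 1 / ((N : ℝ) + 1) :=
    abs_sub_floor_div_le _ _
  have hb' (i : Fin n) : |b s i - r N (j N s).2 i| ≤ 1 / ((N : ℝ) + 1) :=
    abs_sub_floor_div_le _ _
  have h1 := form_le_form_add hF ha' hb' (z s)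
  have h2 := form_le_form_add hF (fun i => abs_sub_comm (a s i) _ ▸ ha' i)
    (fun i => abs_sub_comm (b s i) _ ▸ hb' i) (z s)
  constructor <;> simp only [G] <;> linarith

theorem supExp_eq_ofReal_exp_iSup {X : Type*} {F : Set (X → ℝ)} (hne : F.Nonempty) {v : F → ℝ}
    (hv : BddAbove (Set.range v)) : supExp F v = ENNReal.ofReal (Real.exp (⨆ f, v f)) := by
  have := hne.to_subtype
  have hm : Monotone fun y : ℝ => ENNReal.ofReal (Real.exp y) :=
    fun _ _ h => ENNReal.ofReal_le_ofReal (Real.exp_le_exp.2 h)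
  exact (hm.map_ciSup_of_continuousAt
    (ENNReal.continuous_ofReal.comp Real.continuous_exp).continuousAt hv).symm

theorem IsForm.bddAbove (hF : ∀ f ∈ F, ∀ z, f z ∈ Set.Icc (0 : ℝ) 1) {S : Type*}
    [MeasurableSpace S] {v : S → F → ℝ} (hv : IsForm F v) (s : S) :
    BddAbove (Set.range (v s)) := by
  obtain ⟨n, a, b, z, ha, hb, hz, h⟩ := hv
  rw [funext (h s)]
  exact bddAbove_form hF _ _ _

theorem IsForm.aemeasurable_supExp (hF : ∀ f ∈ F, ∀ z, f z ∈ Set.Icc (0 : ℝ) 1)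
    (hne : F.Nonempty) (hS : HasMeasurableSuprema F) {S : Type*} [MeasurableSpace S]
    {v : S → F → ℝ} (hv : IsForm F v) (Q : Measure S) [IsProbabilityMeasure Q] :
    AEMeasurable (fun s => supExp F (v s)) Q := by
  have e (s : S) := supExp_eq_ofReal_exp_iSup hne (hv.bddAbove hF s)
  obtain ⟨n, a, b, z, ha, hb, hz, h⟩ := hv
  simp only [e, h]
  exact (Real.measurable_exp.comp_aemeasurable
    (aemeasurable_iSup_form hF hne hS Q ha hb hz)).ennreal_ofReal

end Measurability

/-! ### The shifted Wills functional and its convexity -/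

/-- The increment `a ξ f(x) - a² f(x)² / 2` of the exponent of the Wills functional of `a F`
at the point `p.1 = x` and the Gaussian variable `p.2 = ξ`. -/
def willsGain {X : Type*} (F : Set (X → ℝ)) (a : ℝ) (p : X × ℝ) : F → ℝ :=
  fun f => a * p.2 * (f : X → ℝ) p.1 + -(a ^ 2 / 2) * (f : X → ℝ) p.1 ^ 2

/-- The expected Wills functional of `a F` on `n` random points, with the exponent shifted
by `v`. -/
def shiftedWills {X : Type*} [MeasurableSpace X] (μ : Measure X) (F : Set (X → ℝ)) (a : ℝ) :
    ℕ → (F → ℝ) → ℝ≥0∞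
  | 0, v => supExp F v
  | n + 1, v => ∫⁻ p, shiftedWills μ F a n (v + willsGain F a p) ∂(μ.prod (gaussianReal 0 1))

section ShiftedWills

universe u

variable {X : Type u} [MeasurableSpace X] {F : Set (X → ℝ)}

theorem isForm_willsGain (F : Set (X → ℝ)) (a : ℝ) : IsForm F (willsGain F a) :=
  IsForm.single (a := fun p : X × ℝ => a * p.2) (b := fun _ => -(a ^ 2 / 2)) (by fun_prop)
    (by fun_prop) measurable_fst

theorem IsForm.aemeasurable_shiftedWills (hF : ∀ f ∈ F, ∀ z, f z ∈ Set.Icc (0 : ℝ) 1)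
    (hne : F.Nonempty) (hS : HasMeasurableSuprema F) (μ : Measure X) [IsProbabilityMeasure μ]
    (a : ℝ) (n : ℕ) {S : Type*} [MeasurableSpace S] {v : S → F → ℝ} (hv : IsForm F v)
    (Q : Measure S) [IsProbabilityMeasure Q] :
    AEMeasurable (fun s => shiftedWills μ F a n (v s)) Q := by
  -- The induction enlarges the parameter space to `S × (X × ℝ)`, so it is run in the universe of
  -- `X`. An arbitrary `S` is handled by pushing `Q` forward to the space of coefficients and
  -- points.
  have key : ∀ (n : ℕ) {S : Type u} [MeasurableSpace S] {v : S → F → ℝ} (_ : IsForm F v)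
      (Q : Measure S) [IsProbabilityMeasure Q],
      AEMeasurable (fun s => shiftedWills μ F a n (v s)) Q := by
    intro n
    induction n with
    | zero => intro S _ v hv Q _; exact hv.aemeasurable_supExp hF hne hS Q
    | succ n ih =>
      intro S _ v hv Q _
      have h := ih ((hv.comp measurable_fst).add ((isForm_willsGain F a).comp measurable_snd))
        (Q.prod (μ.prod (gaussianReal 0 1)))
      exact h.lintegral_prod_right'
  obtain ⟨m, α, β, z, hα, hβ, hz, h⟩ := hv
  let v₀ : (Fin m → ℝ) × (Fin m → ℝ) × (Fin m → X) → F → ℝ := fun s f =>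
    ∑ i, (s.1 i * (f : X → ℝ) (s.2.2 i) + s.2.1 i * (f : X → ℝ) (s.2.2 i) ^ 2)
  have hv₀ : IsForm F v₀ := ⟨m, fun s => s.1, fun s => s.2.1, fun s => s.2.2, measurable_fst,
    measurable_snd.fst, measurable_snd.snd, fun _ _ => rfl⟩
  have hφ : Measurable fun s => (α s, β s, z s) := hα.prodMk (hβ.prodMk hz)
  have := Measure.isProbabilityMeasure_map (μ := Q) hφ.aemeasurable
  have e (s : S) : v s = v₀ (α s, β s, z s) := funext (h s)
  simp only [e]
  exact (key n hv₀ (Q.map fun s => (α s, β s, z s))).comp_measurable hφ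

/-- Convexity: an inequality between exponentials that holds for each single `f` passes to the
shifted Wills functional. -/
theorem shiftedWills_le_lintegral (hF : ∀ f ∈ F, ∀ z, f z ∈ Set.Icc (0 : ℝ) 1)
    (hne : F.Nonempty) (hS : HasMeasurableSuprema F) (μ : Measure X) [IsProbabilityMeasure μ]
    (a : ℝ) {S : Type*} [MeasurableSpace S] (η : Measure S) [IsProbabilityMeasure η] (n : ℕ)
    {v : S → F → ℝ} (hv : IsForm F v) {v₀ : F → ℝ}
    (h : ∀ f, ENNReal.ofReal (Real.exp (v₀ f)) ≤ ∫⁻ s, ENNReal.ofReal (Real.exp (v s f)) ∂η) :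
    shiftedWills μ F a n v₀ ≤ ∫⁻ s, shiftedWills μ F a n (v s) ∂η := by
  induction n generalizing v v₀ with
  | zero =>
    refine iSup_le fun f => (h f).trans (lintegral_mono fun s => ?_)
    exact le_iSup (fun f => ENNReal.ofReal (Real.exp (v s f))) f
  | succ n ih =>
    have hm : IsForm F fun q : S × (X × ℝ) => v q.1 + willsGain F a q.2 :=
      (hv.comp measurable_fst).add ((isForm_willsGain F a).comp measurable_snd)
    have hswap := lintegral_lintegral_swap (μ := η) (ν := μ.prod (gaussianReal 0 1))
      (f := fun s p => shiftedWills μ F a n (v s + willsGain F a p))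
      (hm.aemeasurable_shiftedWills hF hne hS μ a n _)
    simp only [shiftedWills]
    -- With `p` outside, the factor `exp (willsGain F a p f)` is constant in `s`, so the hypothesis
    -- on each `f` survives adding the gain.
    rw [hswap]
    refine lintegral_mono fun p => ?_
    refine ih (hv.add ((isForm_willsGain F a).const p)) fun f => ?_
    simp only [Pi.add_apply, Real.exp_add, ENNReal.ofReal_mul (Real.exp_nonneg _)]
    rw [lintegral_mul_const' _ _ ENNReal.ofReal_ne_top]
    gcongr
    exact h f

end ShiftedWills

/-! ### Gaussian moments and Jensen's inequality -/

/-- The first absolute moment of the standard Gaussian law. -/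
def gaussianAbsMoment : ℝ := ∫ ξ, |ξ| ∂(gaussianReal 0 1)

theorem integrable_abs_gaussianReal : Integrable (fun ξ : ℝ => |ξ|) (gaussianReal 0 1) :=
  ((memLp_id_gaussianReal 1).integrable (by simp)).abs

/-- The exact value is `2/√(2π)`, and `√(2π) ≤ 3`. -/
theorem gaussianAbsMoment_ge : 2 / 3 ≤ gaussianAbsMoment := by
  have h1 : gaussianAbsMoment =
      2 * ∫ x in Set.Ioi (0 : ℝ), (√(2 * Real.pi))⁻¹ * (x * Real.exp (-(1 / 2) * x ^ 2)) := by
    rw [gaussianAbsMoment, integral_gaussianReal_eq_integral_smul (by simp)]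
    rw [← integral_comp_abs (f := fun x => (√(2 * Real.pi))⁻¹ * (x * Real.exp (-(1 / 2) * x ^ 2)))]
    refine integral_congr_ae (ae_of_all _ fun x => ?_)
    simp [gaussianPDFReal, smul_eq_mul]
    ring_nf
  have h2 : ∫ x in Set.Ioi (0 : ℝ), x * Real.exp (-(1 / 2) * x ^ 2) = 1 := by
    have h := integral_rpow_mul_exp_neg_mul_rpow (p := 2) (q := 1) (b := 1 / 2) (by norm_num)
      (by norm_num) (by norm_num)
    norm_num at h
    simpa only [neg_mul] using h
  have h3 : √(2 * Real.pi) ≤ 3 := by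
    rw [Real.sqrt_le_left (by norm_num)]
    linarith [Real.pi_lt_d2]
  have h4 : 0 < √(2 * Real.pi) := by positivity
  rw [h1, integral_const_mul, h2]
  have h5 : (3 : ℝ)⁻¹ ≤ (√(2 * Real.pi))⁻¹ := inv_anti₀ h4 h3
  linarith

theorem ofReal_exp_le_lintegral {S : Type*} [MeasurableSpace S] (η : Measure S)
    [IsProbabilityMeasure η] {g : S → ℝ} (hg : Integrable g η) {r : ℝ} (hr : r ≤ ∫ s, g s ∂η) :
    ENNReal.ofReal (Real.exp r) ≤ ∫⁻ s, ENNReal.ofReal (Real.exp (g s)) ∂η := by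
  by_cases htop : ∫⁻ s, ENNReal.ofReal (Real.exp (g s)) ∂η = ∞
  · simp [htop]
  have hm : AEStronglyMeasurable (fun s => Real.exp (g s)) η :=
    Real.continuous_exp.comp_aestronglyMeasurable hg.aestronglyMeasurable
  have hint : Integrable (fun s => Real.exp (g s)) η :=
    (lintegral_ofReal_ne_top_iff_integrable hm (ae_of_all _ fun _ => Real.exp_nonneg _)).1 htop
  rw [← ofReal_integral_eq_lintegral_ofReal hint (ae_of_all _ fun _ => Real.exp_nonneg _)]
  refine ENNReal.ofReal_le_ofReal ((Real.exp_le_exp.2 hr).trans ?_)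
  exact convexOn_exp.map_integral_le Real.continuous_exp.continuousOn isClosed_univ
    (ae_of_all _ fun _ => Set.mem_univ _) hg hint

/-- The penalty `y²/2` is the Gaussian log-moment generating function at `y`, so a Wills increment
is exponentially centred for each single `f`. -/
theorem lintegral_exp_gaussianReal (r y : ℝ) :
    ∫⁻ ξ, ENNReal.ofReal (Real.exp (r + (y * ξ + -(y ^ 2 / 2)))) ∂(gaussianReal 0 1) =
      ENNReal.ofReal (Real.exp r) := by
  have hi : Integrable (fun ξ => Real.exp (y * ξ)) (gaussianReal 0 1) :=
    integrable_exp_mul_gaussianReal y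
  have e (ξ : ℝ) : Real.exp (r + (y * ξ + -(y ^ 2 / 2))) =
      Real.exp (r - y ^ 2 / 2) * Real.exp (y * ξ) := by
    rw [← Real.exp_add]; ring_nf
  have hm : ∫ ξ, Real.exp (y * ξ) ∂(gaussianReal 0 1) = Real.exp (y ^ 2 / 2) := by
    have := congrFun (mgf_id_gaussianReal (μ := 0) (v := 1)) y
    simpa [mgf] using this
  simp only [e]
  rw [← ofReal_integral_eq_lintegral_ofReal (hi.const_mul _)
    (ae_of_all _ fun _ => by positivity), integral_const_mul, hm, ← Real.exp_add]
  ring_nf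

/-! ### Monotonicity, rejection sampling and symmetrization -/

section ShiftedWills

variable {X : Type*} [MeasurableSpace X] {F : Set (X → ℝ)}

/-- The increment at `x` has exponential mean one for each `f`, and taking the supremum inside the
expectation can only increase the result. -/
theorem shiftedWills_le_lintegral_gain (hF : ∀ f ∈ F, ∀ z, f z ∈ Set.Icc (0 : ℝ) 1)
    (hne : F.Nonempty) (hS : HasMeasurableSuprema F) (μ : Measure X) [IsProbabilityMeasure μ]
    (a : ℝ) (n : ℕ) {v : F → ℝ} (hv : IsForm F fun _ : Unit => v) (x : X) :
    shiftedWills μ F a n v ≤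
      ∫⁻ ξ, shiftedWills μ F a n (v + willsGain F a (x, ξ)) ∂(gaussianReal 0 1) := by
  refine shiftedWills_le_lintegral hF hne hS μ a (gaussianReal 0 1) n
    ((hv.const ()).add ((isForm_willsGain F a).comp measurable_prodMk_left)) fun f => ?_
  rw [← lintegral_exp_gaussianReal (v f) (a * (f : X → ℝ) x)]
  refine le_of_eq (lintegral_congr fun ξ => ?_)
  simp only [Pi.add_apply, willsGain]
  ring_nf

theorem shiftedWills_succ (hF : ∀ f ∈ F, ∀ z, f z ∈ Set.Icc (0 : ℝ) 1)
    (hne : F.Nonempty) (hS : HasMeasurableSuprema F) (μ : Measure X) [IsProbabilityMeasure μ]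
    (a : ℝ) (n : ℕ) {v : F → ℝ} (hv : IsForm F fun _ : Unit => v) :
    shiftedWills μ F a (n + 1) v =
      ∫⁻ x, ∫⁻ ξ, shiftedWills μ F a n (v + willsGain F a (x, ξ)) ∂(gaussianReal 0 1) ∂μ :=
  lintegral_prod _ (((hv.const ()).add (isForm_willsGain F a)).aemeasurable_shiftedWills
    hF hne hS μ a n _)

theorem shiftedWills_mono (hF : ∀ f ∈ F, ∀ z, f z ∈ Set.Icc (0 : ℝ) 1)
    (hne : F.Nonempty) (hS : HasMeasurableSuprema F) (μ : Measure X) [IsProbabilityMeasure μ]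
    (a : ℝ) {v : F → ℝ} (hv : IsForm F fun _ : Unit => v) :
    Monotone fun n => shiftedWills μ F a n v := by
  refine monotone_nat_of_le_succ fun n => ?_
  rw [shiftedWills_succ hF hne hS μ a n hv]
  refine le_trans ?_ (lintegral_mono fun x =>
    shiftedWills_le_lintegral_gain hF hne hS μ a n hv x)
  simp

/-- Rejection sampling: a sample from a smooth law `ν` is dominated by `k` samples from `μ`. -/
theorem lintegral_smooth_le_shiftedWills (hF : ∀ f ∈ F, ∀ z, f z ∈ Set.Icc (0 : ℝ) 1)
    (hne : F.Nonempty) (hS : HasMeasurableSuprema F) (μ : Measure X) [IsProbabilityMeasure μ]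
    (a : ℝ) (n : ℕ) {v : F → ℝ} (hv : IsForm F fun _ : Unit => v) {σ : ℝ} (hσ : 0 ≤ σ)
    (hσ1 : σ ≤ 1) (ν : Measure X) [IsProbabilityMeasure ν] (hν : ENNReal.ofReal σ • ν ≤ μ)
    (k : ℕ) :
    ENNReal.ofReal (1 - (1 - σ) ^ k) *
      ∫⁻ x, ∫⁻ ξ, shiftedWills μ F a n (v + willsGain F a (x, ξ)) ∂(gaussianReal 0 1) ∂ν ≤
      shiftedWills μ F a (n + k) v := by
  set I := ∫⁻ x, ∫⁻ ξ, shiftedWills μ F a n (v + willsGain F a (x, ξ)) ∂(gaussianReal 0 1) ∂ν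
    with hI
  have hs : ENNReal.ofReal σ ≠ ∞ := ENNReal.ofReal_ne_top
  have hfin : IsFiniteMeasure (ENNReal.ofReal σ • ν) := Measure.smul_finite _ hs
  -- A draw from `μ` is accepted as a draw from `ν` with weight `σ`, and otherwise comes from the
  -- rejected part `ρ`, of mass `1 - σ`.
  set ρ := μ - ENNReal.ofReal σ • ν with hρ
  have hμ : μ = ρ + ENNReal.ofReal σ • ν := (Measure.sub_add_cancel_of_le hν).symm
  have hρ1 : ρ Set.univ = ENNReal.ofReal (1 - σ) := by
    rw [hρ, Measure.sub_apply MeasurableSet.univ hν]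
    simp [ENNReal.ofReal_sub _ hσ]
  induction k with
  | zero => simp
  | succ k ih =>
    rw [← add_assoc, shiftedWills_succ hF hne hS μ a (n + k) hv]
    have h1 : ENNReal.ofReal σ * I ≤ ENNReal.ofReal σ * ∫⁻ x, ∫⁻ ξ, shiftedWills μ F a (n + k)
        (v + willsGain F a (x, ξ)) ∂(gaussianReal 0 1) ∂ν := by
      gcongr ENNReal.ofReal σ * ?_
      refine lintegral_mono fun x => lintegral_mono fun ξ => ?_
      exact shiftedWills_mono hF hne hS μ a
        ((hv.const ()).add ((isForm_willsGain F a).const (x, ξ))) (Nat.le_add_right n k)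
    have h2 : ENNReal.ofReal (1 - σ) * shiftedWills μ F a (n + k) v ≤
        ∫⁻ x, ∫⁻ ξ, shiftedWills μ F a (n + k)
          (v + willsGain F a (x, ξ)) ∂(gaussianReal 0 1) ∂ρ := by
      refine le_trans ?_ (lintegral_mono fun x =>
        shiftedWills_le_lintegral_gain hF hne hS μ a (n + k) hv x)
      rw [lintegral_const, hρ1, mul_comm]
    have h3 : ∀ h : X → ℝ≥0∞, ∫⁻ x, h x ∂μ = ∫⁻ x, h x ∂ρ + ENNReal.ofReal σ * ∫⁻ x, h x ∂ν := by
      intro h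
      conv_lhs => rw [hμ]
      rw [lintegral_add_measure, lintegral_smul_measure, smul_eq_mul]
    rw [h3]
    refine le_trans ?_ (add_le_add h2 h1)
    have hp : 0 ≤ 1 - (1 - σ) ^ k := sub_nonneg.2 (pow_le_one₀ (by linarith) (by linarith))
    -- If the first of `k + 1` draws is rejected, its gain is dropped and `k` attempts remain; if
    -- accepted, the other `k` points are surplus.
    calc ENNReal.ofReal (1 - (1 - σ) ^ (k + 1)) * I
        = ENNReal.ofReal (1 - σ) * (ENNReal.ofReal (1 - (1 - σ) ^ k) * I)
            + ENNReal.ofReal σ * I := by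
          rw [← mul_assoc, ← ENNReal.ofReal_mul (by linarith), ← add_mul,
            ← ENNReal.ofReal_add (mul_nonneg (by linarith) hp) hσ]
          ring_nf
      _ ≤ _ := by gcongr

/-- Jensen replaces `± gaussianAbsMoment` by `± |ξ|`. The unordered pair `{|ξ|, -|ξ|}` equals `{ξ,
-ξ}`, and `ξ` and `-ξ` have the same law. -/
theorem add_shiftedWills_le_lintegral_gain (hF : ∀ f ∈ F, ∀ z, f z ∈ Set.Icc (0 : ℝ) 1)
    (hne : F.Nonempty) (hS : HasMeasurableSuprema F) (μ : Measure X) [IsProbabilityMeasure μ]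
    (a : ℝ) (n : ℕ) {v : F → ℝ} (hv : IsForm F fun _ : Unit => v) (x : X) {v₁ v₂ : F → ℝ}
    (h₁ : ∀ f : F, v₁ f ≤ v f + (a * gaussianAbsMoment * (f : X → ℝ) x
      - a ^ 2 / 2 * (f : X → ℝ) x ^ 2))
    (h₂ : ∀ f : F, v₂ f ≤ v f + (-(a * gaussianAbsMoment * (f : X → ℝ) x)
      - a ^ 2 / 2 * (f : X → ℝ) x ^ 2)) :
    shiftedWills μ F a n v₁ + shiftedWills μ F a n v₂ ≤
      2 * ∫⁻ ξ, shiftedWills μ F a n (v + willsGain F a (x, ξ)) ∂(gaussianReal 0 1) := by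
  set g : ℝ → ℝ≥0∞ := fun ξ => shiftedWills μ F a n (v + willsGain F a (x, ξ)) with hg
  have hform : IsForm F fun ξ : ℝ => v + willsGain F a (x, ξ) :=
    (hv.const ()).add ((isForm_willsGain F a).comp measurable_prodMk_left)
  have hi (s : ℝ) : Integrable (fun ξ : ℝ => s * |ξ|) (gaussianReal 0 1) :=
    integrable_abs_gaussianReal.const_mul s
  have key (s : ℝ) (w : F → ℝ) (hw : ∀ f : F, w f ≤ v f + (s * (a * gaussianAbsMoment *
      (f : X → ℝ) x) - a ^ 2 / 2 * (f : X → ℝ) x ^ 2)) :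
      shiftedWills μ F a n w ≤ ∫⁻ ξ, g (s * |ξ|) ∂(gaussianReal 0 1) := by
    refine shiftedWills_le_lintegral hF hne hS μ a (gaussianReal 0 1) n
      (hform.comp (φ := fun ξ : ℝ => s * |ξ|) (by fun_prop)) fun f => ?_
    have e (ξ : ℝ) : (v + willsGain F a (x, s * |ξ|)) f =
        (v f - a ^ 2 / 2 * (f : X → ℝ) x ^ 2) + (s * a * (f : X → ℝ) x) * |ξ| := by
      simp only [Pi.add_apply, willsGain]; ring
    simp only [e]
    refine ofReal_exp_le_lintegral _ ((integrable_const _).add (hi _)) ?_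
    rw [integral_add' (integrable_const _) (hi _), integral_const_mul]
    simp only [integral_const, probReal_univ, one_smul]
    have := hw f
    rw [gaussianAbsMoment] at this
    linarith
  have hneg : ∫⁻ ξ, g (-ξ) ∂(gaussianReal 0 1) = ∫⁻ ξ, g ξ ∂(gaussianReal 0 1) := by
    have h := lintegral_map_equiv (μ := gaussianReal 0 1) g (MeasurableEquiv.neg ℝ)
    have h' : (gaussianReal 0 1).map (MeasurableEquiv.neg ℝ) = gaussianReal 0 1 := by
      have := gaussianReal_map_neg (μ := 0) (v := 1)
      simpa using this
    rw [h'] at h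
    exact h.symm
  have hm (s : ℝ) : AEMeasurable (fun ξ => g (s * |ξ|)) (gaussianReal 0 1) :=
    (hform.comp (φ := fun ξ : ℝ => s * |ξ|) (by fun_prop)).aemeasurable_shiftedWills hF hne hS
      μ a n _
  have hm' : AEMeasurable g (gaussianReal 0 1) := hform.aemeasurable_shiftedWills hF hne hS μ a n _
  calc shiftedWills μ F a n v₁ + shiftedWills μ F a n v₂
      ≤ ∫⁻ ξ, g (1 * |ξ|) ∂(gaussianReal 0 1) + ∫⁻ ξ, g (-1 * |ξ|) ∂(gaussianReal 0 1) := by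
        refine add_le_add (key 1 v₁ fun f => ?_) (key (-1) v₂ fun f => ?_)
        · simpa using h₁ f
        · simpa using h₂ f
    _ = ∫⁻ ξ, (g (1 * |ξ|) + g (-1 * |ξ|)) ∂(gaussianReal 0 1) :=
        (lintegral_add_left' (hm 1) _).symm
    _ = ∫⁻ ξ, (g ξ + g (-ξ)) ∂(gaussianReal 0 1) := by
        refine lintegral_congr fun ξ => ?_
        rcases abs_choice ξ with h | h <;> simp [h, add_comm]
    _ = 2 * ∫⁻ ξ, g ξ ∂(gaussianReal 0 1) := by
        rw [lintegral_add_left' hm', hneg, two_mul]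

/-- Midpoint convexity, obtained from `shiftedWills_le_lintegral` with a fair coin choosing between
`v₁` and `v₂`. -/
theorem two_mul_shiftedWills_le_add (hF : ∀ f ∈ F, ∀ z, f z ∈ Set.Icc (0 : ℝ) 1)
    (hne : F.Nonempty) (hS : HasMeasurableSuprema F) (μ : Measure X) [IsProbabilityMeasure μ]
    (a : ℝ) (n : ℕ) {v v₁ v₂ : F → ℝ} (h₁ : IsForm F fun _ : Unit => v₁)
    (h₂ : IsForm F fun _ : Unit => v₂) (h : ∀ f, 2 * v f = v₁ f + v₂ f) :
    2 * shiftedWills μ F a n v ≤ shiftedWills μ F a n v₁ + shiftedWills μ F a n v₂ := by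
  let η : Measure Bool := (2 : ℝ≥0∞)⁻¹ • (Measure.dirac true + Measure.dirac false)
  have hη (g : Bool → ℝ≥0∞) : ∫⁻ s, g s ∂η = 2⁻¹ * (g true + g false) := by
    simp [η, lintegral_add_measure, mul_add]
  have : IsProbabilityMeasure η := ⟨by
    rw [← lintegral_one, hη, one_add_one_eq_two]
    exact ENNReal.inv_mul_cancel (by simp) (by simp)⟩
  have hform : IsForm F fun s : Bool => (bif s then (1 : ℝ) else 0) • v₁ +
      (bif s then (0 : ℝ) else 1) • v₂ :=
    ((h₁.const ()).smul (measurable_of_countable _)).add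
      ((h₂.const ()).smul (measurable_of_countable _))
  have key := shiftedWills_le_lintegral hF hne hS μ a η n hform (v₀ := v) fun f => by
    refine ofReal_exp_le_lintegral η (.of_finite) (le_of_eq ?_)
    simp only [η]
    rw [integral_smul_measure, integral_add_measure .of_finite .of_finite]
    simp
    linarith [h f]
  rw [hη] at key
  calc 2 * shiftedWills μ F a n v ≤ 2 * (2⁻¹ * _) := by gcongr
    _ = _ := by
      rw [← mul_assoc, ENNReal.mul_inv_cancel (by simp) (by simp), one_mul]
      simp

end ShiftedWills

/-! ### Smooth laws and disintegration -/

theorem IsSmooth.smul_le {X : Type*} [MeasurableSpace X] {σ : ℝ} {p μ : Measure X}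
    [SigmaFinite p] [SigmaFinite μ] (hσ : 0 < σ) (h : IsSmooth σ p μ) :
    ENNReal.ofReal σ • p ≤ μ := by
  refine Measure.le_iff.2 fun A hA => ?_
  have h1 : p A ≤ ENNReal.ofReal (1 / σ) * μ A := by
    rw [← Measure.setLIntegral_rnDeriv h.1 A, ← setLIntegral_const]
    refine lintegral_mono_ae (ae_restrict_of_ae ?_)
    filter_upwards [ENNReal.ae_le_essSup (p.rnDeriv μ)] with x hx
    exact hx.trans h.2
  calc (ENNReal.ofReal σ • p) A ≤ ENNReal.ofReal σ * (ENNReal.ofReal (1 / σ) * μ A) := by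
        rw [Measure.smul_apply, smul_eq_mul]; gcongr
    _ = μ A := by
        rw [← mul_assoc, ← ENNReal.ofReal_mul hσ.le, mul_one_div_cancel hσ.ne']; simp

theorem IsSmooth.le_one {X : Type*} [MeasurableSpace X] {σ : ℝ} {p μ : Measure X}
    [IsProbabilityMeasure p] [IsProbabilityMeasure μ] (hσ : 0 < σ) (h : IsSmooth σ p μ) :
    σ ≤ 1 := by
  have := Measure.le_iff'.1 (h.smul_le hσ) Set.univ
  simpa using this

/-- Disintegration along a conditional law given as a kernel, without assumptions on the
measurable spaces. -/
theorem lintegral_eq_lintegral_kernel {Ω Ω' X : Type*} [MeasurableSpace Ω] [MeasurableSpace Ω']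
    [MeasurableSpace X] (P : Measure Ω) [IsProbabilityMeasure P] {π : Ω → Ω'} (hπ : Measurable π)
    (κ : Kernel Ω' X) [IsMarkovKernel κ] {y : Ω → X} (hy : Measurable y)
    (hlaw : ∀ D A, MeasurableSet D → MeasurableSet A →
      P (π ⁻¹' D ∩ y ⁻¹' A) = ∫⁻ ω in π ⁻¹' D, κ (π ω) A ∂P)
    {h : Ω' × X → ℝ≥0∞}
    (hh : ∀ (Q : Measure (Ω' × X)) [IsProbabilityMeasure Q], AEMeasurable h Q) :
    ∫⁻ ω, h (π ω, y ω) ∂P = ∫⁻ ω, ∫⁻ z, h (π ω, z) ∂(κ (π ω)) ∂P := by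
  have hpy : Measurable fun ω => (π ω, y ω) := hπ.prodMk hy
  have := Measure.isProbabilityMeasure_map (μ := P) hπ.aemeasurable
  have hmap : P.map (fun ω => (π ω, y ω)) = (P.map π) ⊗ₘ κ := by
    have := Measure.isProbabilityMeasure_map (μ := P) hpy.aemeasurable
    refine Measure.ext_prod fun {D} {A} hD hA => ?_
    rw [Measure.map_apply hpy (hD.prod hA), Measure.compProd_apply_prod hD hA,
      setLIntegral_map hD (κ.measurable_coe hA) hπ, ← hlaw D A hD hA]
    rfl
  -- `h` is only almost everywhere measurable, so the disintegration is applied to a measurable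
  -- version for the joint law. The two agree `κ`-almost everywhere on almost every fibre.
  have hQ := hh ((P.map π) ⊗ₘ κ)
  have hae := ae_of_ae_map hπ.aemeasurable (Measure.ae_ae_of_ae_compProd hQ.ae_eq_mk)
  have hmk := hQ.measurable_mk
  calc ∫⁻ ω, h (π ω, y ω) ∂P = ∫⁻ q, h q ∂((P.map π) ⊗ₘ κ) := by
        rw [← hmap] at hQ ⊢
        rw [lintegral_map' hQ hpy.aemeasurable]
    _ = ∫⁻ q, hQ.mk h q ∂((P.map π) ⊗ₘ κ) := lintegral_congr_ae hQ.ae_eq_mk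
    _ = ∫⁻ ω, ∫⁻ z, hQ.mk h (π ω, z) ∂(κ (π ω)) ∂P := by
        rw [Measure.lintegral_compProd hmk, lintegral_map hmk.lintegral_kernel_prod_right' hπ]
    _ = ∫⁻ ω, ∫⁻ z, h (π ω, z) ∂(κ (π ω)) ∂P := by
        refine lintegral_congr_ae ?_
        filter_upwards [hae] with ω hω
        refine lintegral_congr_ae ?_
        filter_upwards [hω] with z hz using hz.symm

/-! ### One round of the process -/

section Step

variable {X : Type*} [MeasurableSpace X] {F : Set (X → ℝ)}

/-- One round: the increment of the exponent in that round is replaced by `k` samples from `μ`. -/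
theorem lintegral_shiftedWills_step (hF : ∀ f ∈ F, ∀ z, f z ∈ Set.Icc (0 : ℝ) 1)
    (hne : F.Nonempty) (hS : HasMeasurableSuprema F) (μ : Measure X) [IsProbabilityMeasure μ]
    {a l c σ : ℝ} (hl : 2 * l * (1 + c) = a * gaussianAbsMoment) (hc : a ^ 2 / 2 ≤ 2 * l * c)
    (hσ : 0 ≤ σ) (hσ1 : σ ≤ 1)
    {Ω Ω' : Type*} {mΩ : MeasurableSpace Ω} {mΩ' : MeasurableSpace Ω'}
    (P : Measure Ω) [IsProbabilityMeasure P] {π : Ω → Ω'} (hπ : Measurable π)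
    (κ : Kernel Ω' X) [IsMarkovKernel κ] (hκ : ∀ᵐ ω ∂P, ENNReal.ofReal σ • κ (π ω) ≤ μ)
    {y y' : Ω → X} (hy : Measurable y) (hy' : Measurable y')
    (hlaw : ∀ D A, MeasurableSet D → MeasurableSet A →
      P (π ⁻¹' D ∩ y ⁻¹' A) = ∫⁻ ω in π ⁻¹' D, κ (π ω) A ∂P)
    (hlaw' : ∀ D A, MeasurableSet D → MeasurableSet A →
      P (π ⁻¹' D ∩ y' ⁻¹' A) = ∫⁻ ω in π ⁻¹' D, κ (π ω) A ∂P)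
    {v : Ω' → F → ℝ} (hv : IsForm F v) {b : Ω' → ℝ} (hb : Measurable b)
    (hb01 : ∀ ω, b ω = 0 ∨ b ω = 1) (n k : ℕ) :
    ENNReal.ofReal (1 - (1 - σ) ^ k) * ∫⁻ ω, shiftedWills μ F a n (v (π ω) + fun f : F =>
        b (π ω) * (l * ((f : X → ℝ) (y' ω) - (1 + 2 * c) * (f : X → ℝ) (y ω)))) ∂P ≤
      ∫⁻ ω, shiftedWills μ F a (n + k) (v (π ω)) ∂P := by
  set θ := ENNReal.ofReal (1 - (1 - σ) ^ k) with hθ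
  let v₁ : Ω' × X → F → ℝ := fun q => v q.1 + fun f : F => b q.1 * (2 * l) * (f : X → ℝ) q.2 +
    0 * (f : X → ℝ) q.2 ^ 2
  let v₂ : Ω' × X → F → ℝ := fun q => v q.1 + fun f : F =>
    b q.1 * (-(2 * l * (1 + 2 * c))) * (f : X → ℝ) q.2 + 0 * (f : X → ℝ) q.2 ^ 2
  have hv₁ : IsForm F v₁ := (hv.comp measurable_fst).add
    (IsForm.single ((hb.comp measurable_fst).mul_const _) measurable_const measurable_snd)
  have hv₂ : IsForm F v₂ := (hv.comp measurable_fst).add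
    (IsForm.single ((hb.comp measurable_fst).mul_const _) measurable_const measurable_snd)
  have hπy' : Measurable fun ω => (π ω, y' ω) := hπ.prodMk hy'
  have e₁ := lintegral_eq_lintegral_kernel P hπ κ hy' hlaw'
    (h := fun q => shiftedWills μ F a n (v₁ q))
    (fun Q _ => hv₁.aemeasurable_shiftedWills hF hne hS μ a n Q)
  have e₂ := lintegral_eq_lintegral_kernel P hπ κ hy hlaw
    (h := fun q => shiftedWills μ F a n (v₂ q))
    (fun Q _ => hv₂.aemeasurable_shiftedWills hF hne hS μ a n Q)
  have hpt (ω' : Ω') (z : X) : shiftedWills μ F a n (v₁ (ω', z)) +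
      shiftedWills μ F a n (v₂ (ω', z)) ≤
      2 * ∫⁻ ξ, shiftedWills μ F a n (v ω' + willsGain F a (z, ξ)) ∂(gaussianReal 0 1) := by
    -- After stopping (`b = 0`) the exponent is unchanged, and inserting a gain costs nothing.
    rcases hb01 ω' with h0 | h1
    · have i₁ : v₁ (ω', z) = v ω' := by ext f; simp [v₁, h0]
      have i₂ : v₂ (ω', z) = v ω' := by ext f; simp [v₂, h0]
      rw [i₁, i₂, ← two_mul]
      gcongr
      exact shiftedWills_le_lintegral_gain hF hne hS μ a n (hv.const ω') z
    · refine add_shiftedWills_le_lintegral_gain hF hne hS μ a n (hv.const ω') z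
        (fun f => ?_) (fun f => ?_)
      all_goals
        obtain ⟨hf0, hf1⟩ := hF f f.2 z
        -- This is where the range `[0, 1]` enters: `f² ≤ f` lets the linear drift `2lc f` absorb
        -- the quadratic penalty.
        have hq : a ^ 2 / 2 * (f : X → ℝ) z ^ 2 ≤ 2 * l * c * (f : X → ℝ) z := by
          have : (f : X → ℝ) z ^ 2 ≤ (f : X → ℝ) z := by nlinarith
          calc _ ≤ a ^ 2 / 2 * (f : X → ℝ) z := by gcongr
            _ ≤ _ := by gcongr
        simp only [v₁, v₂, h1, Pi.add_apply, ← hl]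
        linarith
  have hsum : 2 * ∫⁻ ω, shiftedWills μ F a n (v (π ω) + fun f : F =>
        b (π ω) * (l * ((f : X → ℝ) (y' ω) - (1 + 2 * c) * (f : X → ℝ) (y ω)))) ∂P ≤
      2 * ∫⁻ ω, ∫⁻ z, ∫⁻ ξ, shiftedWills μ F a n (v (π ω) + willsGain F a (z, ξ))
        ∂(gaussianReal 0 1) ∂(κ (π ω)) ∂P := by
    rw [← lintegral_const_mul' _ _ (by simp), ← lintegral_const_mul' _ _ (by simp)]
    calc _ ≤ ∫⁻ ω, (shiftedWills μ F a n (v₁ (π ω, y' ω)) +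
          shiftedWills μ F a n (v₂ (π ω, y ω))) ∂P := by
          refine lintegral_mono fun ω => ?_
          refine two_mul_shiftedWills_le_add hF hne hS μ a n (hv₁.const _) (hv₂.const _)
            fun f => ?_
          simp only [v₁, v₂, Pi.add_apply]
          ring
      _ = ∫⁻ ω, ∫⁻ z, shiftedWills μ F a n (v₁ (π ω, z)) ∂(κ (π ω)) ∂P +
          ∫⁻ ω, ∫⁻ z, shiftedWills μ F a n (v₂ (π ω, z)) ∂(κ (π ω)) ∂P := by
          rw [lintegral_add_left' ((hv₁.comp hπy').aemeasurable_shiftedWills hF hne hS μ a n P),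
            e₁, e₂]
      _ ≤ ∫⁻ ω, ∫⁻ z, (shiftedWills μ F a n (v₁ (π ω, z)) +
          shiftedWills μ F a n (v₂ (π ω, z))) ∂(κ (π ω)) ∂P :=
          (le_lintegral_add _ _).trans (lintegral_mono fun ω => le_lintegral_add _ _)
      _ ≤ _ := by
          refine lintegral_mono fun ω => ?_
          rw [← lintegral_const_mul' _ _ (by simp)]
          exact lintegral_mono fun z => hpt (π ω) z
  have hsum' := (ENNReal.mul_le_mul_iff_right (by simp) (by simp)).1 hsum
  calc _ ≤ θ * _ := mul_le_mul_right hsum' θ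
    _ ≤ _ := by
      rw [← lintegral_const_mul' _ _ ENNReal.ofReal_ne_top]
      refine lintegral_mono_ae ?_
      filter_upwards [hκ] with ω hω
      exact lintegral_smooth_le_shiftedWills hF hne hS μ a n (hv.const _) hσ hσ1 _ hω k

end Step

/-- The law of `y` given `m` in the form of an identity between measures of sets. -/
theorem measure_inter_eq_of_condExp {Ω X : Type*} {m mΩ : MeasurableSpace Ω} [MeasurableSpace X]
    (hm : m ≤ mΩ) (P : Measure Ω) [IsProbabilityMeasure P] (κ : Ω → Measure X)
    [∀ ω, IsProbabilityMeasure (κ ω)] {y : Ω → X} (hy : Measurable y)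
    {A : Set X} (hA : MeasurableSet A) (hκ : Measurable fun ω => κ ω A)
    (h : P⟦y ⁻¹' A | m⟧ =ᵐ[P] fun ω => (κ ω).real A) {D : Set Ω} (hD : MeasurableSet[m] D) :
    P (D ∩ y ⁻¹' A) = ∫⁻ ω in D, κ ω A ∂P := by
  have hi : Integrable ((y ⁻¹' A).indicator fun _ => (1 : ℝ)) P :=
    (integrable_const 1).indicator (hy hA)
  have h1 := setIntegral_condExp hm hi hD
  rw [setIntegral_congr_ae (g := fun ω => (κ ω).real A) (hm _ hD)
    (h.mono fun ω hω _ => hω), integral_indicator (hy hA)] at h1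
  simp only [integral_const, smul_eq_mul, mul_one, Measure.real] at h1
  rw [integral_toReal hκ.aemeasurable (ae_of_all _ fun ω => measure_lt_top _ _)] at h1
  rw [Measure.restrict_apply MeasurableSet.univ, Set.univ_inter,
    Measure.restrict_apply (hy hA), Set.inter_comm] at h1
  refine ((ENNReal.toReal_eq_toReal_iff' ?_ (measure_ne_top _ _)).1 h1).symm
  refine ne_top_of_le_ne_top ENNReal.one_ne_top ?_
  calc ∫⁻ ω in D, κ ω A ∂P ≤ ∫⁻ ω in D, 1 ∂P := lintegral_mono fun ω => prob_le_one
    _ ≤ 1 := by simpa using prob_le_one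

/-! ### Identification with the expected Wills functional -/

section ExpectedWills

variable {X : Type*} [MeasurableSpace X] {F : Set (X → ℝ)}

theorem isForm_sum_willsGain (F : Set (X → ℝ)) (a : ℝ) (n : ℕ) :
    IsForm F fun q : Fin n → X × ℝ => ∑ i, willsGain F a (q i) :=
  IsForm.sum _ fun i _ => (isForm_willsGain F a).comp (measurable_pi_apply i)

theorem shiftedWills_eq_lintegral_pi (hF : ∀ f ∈ F, ∀ z, f z ∈ Set.Icc (0 : ℝ) 1)
    (hne : F.Nonempty) (hS : HasMeasurableSuprema F) (μ : Measure X) [IsProbabilityMeasure μ]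
    (a : ℝ) (n : ℕ) {v : F → ℝ} (hv : IsForm F fun _ : Unit => v) :
    shiftedWills μ F a n v = ∫⁻ q : Fin n → X × ℝ, supExp F (v + ∑ i, willsGain F a (q i))
      ∂(Measure.pi fun _ => μ.prod (gaussianReal 0 1)) := by
  induction n generalizing v with
  | zero => simp [shiftedWills]
  | succ n ih =>
    have he := (measurePreserving_piFinSuccAbove
      (fun _ : Fin (n + 1) => μ.prod (gaussianReal 0 1)) 0).symm
    have hm : AEMeasurable (fun q : (X × ℝ) × (Fin n → X × ℝ) =>
        supExp F (v + willsGain F a q.1 + ∑ i, willsGain F a (q.2 i)))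
        ((μ.prod (gaussianReal 0 1)).prod (Measure.pi fun _ => μ.prod (gaussianReal 0 1))) :=
      (((hv.const ()).add ((isForm_willsGain F a).comp measurable_fst)).add
        ((isForm_sum_willsGain F a n).comp measurable_snd)).aemeasurable_supExp hF hne hS _
    rw [← he.lintegral_comp_emb (MeasurableEquiv.measurableEmbedding _)]
    simp only [shiftedWills]
    refine (lintegral_congr fun p => ih (v := v + willsGain F a p) ((hv.const ()).add
      ((isForm_willsGain F a).const p))).trans ?_
    rw [← lintegral_prod _ hm]
    refine lintegral_congr fun q => ?_
    simp [MeasurableEquiv.piFinSuccAbove_symm_apply, Fin.sum_univ_succ, add_assoc]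

theorem supExp_add_willsGain_le {X : Type*} {F : Set (X → ℝ)}
    (hF : ∀ f ∈ F, ∀ z, f z ∈ Set.Icc (0 : ℝ) 1) (a : ℝ)
    (v : F → ℝ) (p : X × ℝ) :
    supExp F (v + willsGain F a p) ≤ supExp F v * ENNReal.ofReal (Real.exp (|a * p.2|)) := by
  refine iSup_le fun f => ?_
  refine le_trans ?_ (mul_le_mul_left (le_iSup (fun f => ENNReal.ofReal (Real.exp (v f))) f) _)
  rw [← ENNReal.ofReal_mul (Real.exp_nonneg _), ← Real.exp_add]
  refine ENNReal.ofReal_le_ofReal (Real.exp_le_exp.2 ?_)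
  obtain ⟨h0, h1⟩ := hF f f.2 p.1
  have e1 : a * p.2 * (f : X → ℝ) p.1 ≤ |a * p.2| :=
    (mul_le_mul_of_nonneg_right (le_abs_self _) h0).trans (mul_le_of_le_one_right (abs_nonneg _) h1)
  have e2 : 0 ≤ a ^ 2 / 2 * (f : X → ℝ) p.1 ^ 2 := by positivity
  simp only [Pi.add_apply, willsGain]
  linarith

theorem lintegral_exp_abs_gaussianReal_ne_top (a : ℝ) :
    ∫⁻ ξ, ENNReal.ofReal (Real.exp |a * ξ|) ∂(gaussianReal 0 1) ≠ ∞ := by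
  have h : Integrable (fun ξ => Real.exp |a * ξ|) (gaussianReal 0 1) := by
    simp only [abs_mul]
    have := integrable_exp_mul_abs (X := id) (t := |a|)
      (μ := gaussianReal 0 1) (integrable_exp_mul_gaussianReal _) (integrable_exp_mul_gaussianReal _)
    simpa using this
  exact (lintegral_ofReal_ne_top_iff_integrable h.aestronglyMeasurable
    (ae_of_all _ fun _ => Real.exp_nonneg _)).2 h

/-- Supplies the finiteness needed to pass from the `[0, ∞]`-valued functional to the Bochner
integrals defining `expectedWills`. -/
theorem shiftedWills_le_mul_pow (hF : ∀ f ∈ F, ∀ z, f z ∈ Set.Icc (0 : ℝ) 1)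
    (μ : Measure X) [IsProbabilityMeasure μ] (a : ℝ) (n : ℕ) (v : F → ℝ) :
    shiftedWills μ F a n v ≤ supExp F v *
      (∫⁻ ξ, ENNReal.ofReal (Real.exp |a * ξ|) ∂(gaussianReal 0 1)) ^ n := by
  set K := ∫⁻ ξ, ENNReal.ofReal (Real.exp |a * ξ|) ∂(gaussianReal 0 1) with hK
  have hm : Measurable fun p : X × ℝ => ENNReal.ofReal (Real.exp |a * p.2|) :=
    (Real.measurable_exp.comp (measurable_snd.const_mul a).abs).ennreal_ofReal
  induction n generalizing v with
  | zero => simp [shiftedWills]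
  | succ n ih =>
    calc shiftedWills μ F a (n + 1) v
        ≤ ∫⁻ p, supExp F v * (K ^ n) * ENNReal.ofReal (Real.exp |a * p.2|)
            ∂(μ.prod (gaussianReal 0 1)) := by
          refine lintegral_mono fun p => (ih _).trans ?_
          rw [mul_right_comm]
          gcongr
          exact supExp_add_willsGain_le hF a v p
      _ = _ := by
          rw [lintegral_const_mul _ hm, lintegral_prod _ hm.aemeasurable]
          simp only [lintegral_const, measure_univ, mul_one, ← hK]
          rw [pow_succ, mul_assoc]

theorem supExp_zero {X : Type*} {F : Set (X → ℝ)} (hne : F.Nonempty) : supExp F 0 = 1 := by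
  have := hne.to_subtype
  simp [supExp]

theorem one_le_shiftedWills_zero (hF : ∀ f ∈ F, ∀ z, f z ∈ Set.Icc (0 : ℝ) 1)
    (hne : F.Nonempty) (hS : HasMeasurableSuprema F) (μ : Measure X) [IsProbabilityMeasure μ]
    (a : ℝ) (n : ℕ) : 1 ≤ shiftedWills μ F a n 0 := by
  have := shiftedWills_mono hF hne hS μ a (v := 0) IsForm.zero (Nat.zero_le n)
  rw [← supExp_zero hne]
  exact this

theorem willsFunctional_smul {X : Type*} {F : Set (X → ℝ)} (a : ℝ) {n : ℕ} (Z : Fin n → X) :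
    willsFunctional (a • F) Z = ∫ ξ : Fin n → ℝ,
      Real.exp (⨆ f : F, (∑ i, willsGain F a (Z i, ξ i)) f)
      ∂(Measure.pi fun _ => gaussianReal 0 1) := by
  rw [willsFunctional]
  refine integral_congr_ae (ae_of_all _ fun ξ => ?_)
  let φ : F → (a • F : Set (X → ℝ)) := fun f => ⟨a • f, Set.smul_mem_smul_set f.2⟩
  have hφ : Function.Surjective φ := by
    rintro ⟨_, f, hf, rfl⟩
    exact ⟨⟨f, hf⟩, rfl⟩
  simp only
  rw [← hφ.iSup_comp]
  congr 2
  ext f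
  rw [Finset.sum_apply]
  refine Finset.sum_congr rfl fun i _ => ?_
  simp [φ, willsGain]
  ring

theorem ofReal_expectedWills (hF : ∀ f ∈ F, ∀ z, f z ∈ Set.Icc (0 : ℝ) 1)
    (hne : F.Nonempty) (hS : HasMeasurableSuprema F) (μ : Measure X) [IsProbabilityMeasure μ]
    (a : ℝ) (n : ℕ) :
    ENNReal.ofReal (expectedWills μ (a • F) n) = shiftedWills μ F a n 0 := by
  let e := MeasurableEquiv.arrowProdEquivProdArrow X ℝ (Fin n)
  have he : MeasurePreserving e (Measure.pi fun _ => μ.prod (gaussianReal 0 1))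
      ((Measure.pi fun _ => μ).prod (Measure.pi fun _ => gaussianReal 0 1)) :=
    measurePreserving_arrowProdEquivProdArrow X ℝ (Fin n) (fun _ => μ) fun _ => gaussianReal 0 1
  let w : (Fin n → X) × (Fin n → ℝ) → F → ℝ := fun q => ∑ i, willsGain F a (q.1 i, q.2 i)
  have hw : IsForm F w := (isForm_sum_willsGain F a n).comp e.symm.measurable
  have hsup (q) : supExp F (w q) = ENNReal.ofReal (Real.exp (⨆ f, w q f)) :=
    supExp_eq_ofReal_exp_iSup hne (hw.bddAbove hF q)
  have hm : AEMeasurable (fun q => Real.exp (⨆ f, w q f))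
      ((Measure.pi fun _ => μ).prod (Measure.pi fun _ => gaussianReal 0 1)) := by
    refine (hw.aemeasurable_supExp hF hne hS _).ennreal_toReal.congr (ae_of_all _ fun q => ?_)
    simp only [hsup, ENNReal.toReal_ofReal (Real.exp_nonneg _)]
  have hΓ : shiftedWills μ F a n 0 = ∫⁻ q, ENNReal.ofReal (Real.exp (⨆ f, w q f))
      ∂((Measure.pi fun _ => μ).prod (Measure.pi fun _ => gaussianReal 0 1)) := by
    rw [shiftedWills_eq_lintegral_pi hF hne hS μ a n IsForm.zero,
      ← he.lintegral_comp_emb e.measurableEmbedding]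
    refine lintegral_congr fun q => ?_
    rw [← hsup, zero_add]
    rfl
  have hfin : shiftedWills μ F a n 0 ≠ ∞ := by
    refine ne_top_of_le_ne_top ?_ (shiftedWills_le_mul_pow hF μ a n 0)
    rw [supExp_zero hne, one_mul]
    exact ENNReal.pow_ne_top (lintegral_exp_abs_gaussianReal_ne_top a)
  have hint := (lintegral_ofReal_ne_top_iff_integrable hm.aestronglyMeasurable
    (ae_of_all _ fun _ => Real.exp_nonneg _)).1 (hΓ ▸ hfin)
  rw [hΓ, ← ofReal_integral_eq_lintegral_ofReal hint (ae_of_all _ fun _ => Real.exp_nonneg _),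
    integral_prod _ hint, expectedWills]
  simp only [willsFunctional_smul]
  rfl

end ExpectedWills

/-! ### Iteration along the tangent sequence -/

section TangentSequence

variable {X : Type*} [mX : MeasurableSpace X] {F : Set (X → ℝ)} {Ω : Type*}
  {mΩ : MeasurableSpace Ω}

/-- The exponent `l ∑_{s ≤ min t τ} (f (x' s) - (1 + 2 c) f (x s))`. -/
def stoppedExponent (F : Set (X → ℝ)) (l c : ℝ) (x x' : ℕ → Ω → X) (τ : Ω → ℕ) (t : ℕ) (ω : Ω) :
    F → ℝ :=
  ∑ s ∈ Finset.range t, fun f : F => (if s + 1 ≤ τ ω then (1 : ℝ) else 0) *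
    (l * ((f : X → ℝ) (x' (s + 1) ω) - (1 + 2 * c) * (f : X → ℝ) (x (s + 1) ω)))

theorem jointHistory_le {H : Filtration ℕ mΩ} {x' : ℕ → Ω → X} {T : ℕ}
    (hx' : ∀ t < T, Measurable (x' (t + 1))) {t : ℕ} (ht : t ≤ T) :
    jointHistory H x' t ≤ mΩ := by
  refine sup_le (H.le t) (iSup₂_le fun s hs => ?_)
  obtain ⟨r, rfl⟩ := Nat.exists_eq_add_of_le' hs.1
  exact (hx' r (by have := hs.2; omega)).comap_le

/-- The event is the complement of `{τ ≤ s}`: whether round `s + 1` counts is already known at time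
`s`, before its points are drawn. -/
theorem measurable_indicator_le_stopping {H : Filtration ℕ mΩ} {τ : Ω → ℕ}
    (hτ : IsStoppingTime H fun ω => (τ ω : WithTop ℕ)) (s : ℕ) :
    Measurable[H s] fun ω => if s + 1 ≤ τ ω then (1 : ℝ) else 0 := by
  have h : MeasurableSet[H s] {ω | s + 1 ≤ τ ω} := by
    have := (hτ s).compl
    convert this using 1
    ext ω
    simp
  exact Measurable.ite h measurable_const measurable_const

theorem isForm_stoppedExponent {H : Filtration ℕ mΩ} {x x' : ℕ → Ω → X} {T : ℕ} {τ : Ω → ℕ}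
    (hx : ∀ t < T, Measurable[H (t + 1)] (x (t + 1)))
    (hτ : IsStoppingTime H fun ω => (τ ω : WithTop ℕ)) (l c : ℝ) {t : ℕ} (ht : t ≤ T) :
    @IsForm X mX F Ω (jointHistory H x' t) (stoppedExponent F l c x x' τ t) := by
  refine @IsForm.sum X mX F Ω (jointHistory H x' t) ℕ (Finset.range t) _ fun s hs => ?_
  have hst : s + 1 ≤ t := Finset.mem_range.1 hs
  have hle (r : ℕ) (hr : r ≤ t) : H r ≤ jointHistory H x' t := (H.mono hr).trans le_sup_left
  have hb : Measurable[jointHistory H x' t] fun ω => if s + 1 ≤ τ ω then (1 : ℝ) else 0 :=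
    (measurable_indicator_le_stopping hτ s).mono (hle s (by omega)) le_rfl
  have h1 : Measurable[jointHistory H x' t] (x (s + 1)) :=
    (hx s (by omega)).mono (hle _ hst) le_rfl
  have h2 : Measurable[jointHistory H x' t] (x' (s + 1)) := by
    refine Measurable.of_comap_le (le_trans ?_ le_sup_right)
    exact le_iSup₂_of_le (f := fun s (_ : s ∈ Set.Icc 1 t) => mX.comap (x' s)) (s + 1)
      ⟨by omega, hst⟩ le_rfl
  have f1 := @IsForm.single X mX F Ω (jointHistory H x' t) _ _ _
    (hb.const_mul l)
    (@measurable_const _ _ _ (jointHistory H x' t) 0) h2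
  have f2 := @IsForm.single X mX F Ω (jointHistory H x' t) _ _ _
    (hb.const_mul (-(l * (1 + 2 * c))))
    (@measurable_const _ _ _ (jointHistory H x' t) 0) h1
  have f3 := @IsForm.add X mX F Ω (jointHistory H x' t) _ _ f1 f2
  convert f3 using 1
  ext ω f
  simp only [Pi.add_apply]
  ring

end TangentSequence

section TangentSequence

variable {X : Type*} [mX : MeasurableSpace X] {F : Set (X → ℝ)} {Ω : Type*}
  {mΩ : MeasurableSpace Ω}

theorem lintegral_stoppedExponent_succ (hF : ∀ f ∈ F, ∀ z, f z ∈ Set.Icc (0 : ℝ) 1)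
    (hne : F.Nonempty) (hS : HasMeasurableSuprema F) (μ : Measure X) [IsProbabilityMeasure μ]
    {a l c σ : ℝ} (hl : 2 * l * (1 + c) = a * gaussianAbsMoment) (hc : a ^ 2 / 2 ≤ 2 * l * c)
    (hσ : 0 < σ) (hσ1 : σ ≤ 1) (P : Measure Ω) [IsProbabilityMeasure P] {H : Filtration ℕ mΩ}
    {x x' : ℕ → Ω → X} {T : ℕ} (hx : IsSmoothProcess P H x T σ μ) (hx' : IsTangent P H x x' T)
    {τ : Ω → ℕ} (hτ : IsStoppingTime H fun ω => (τ ω : WithTop ℕ)) {t : ℕ} (ht : t < T)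
    (n k : ℕ) :
    ENNReal.ofReal (1 - (1 - σ) ^ k) *
        ∫⁻ ω, shiftedWills μ F a n (stoppedExponent F l c x x' τ (t + 1) ω) ∂P ≤
      ∫⁻ ω, shiftedWills μ F a (n + k) (stoppedExponent F l c x x' τ t ω) ∂P := by
  obtain ⟨ν, hν, hsm, hlaw⟩ := hx.smooth t ht
  have hm : jointHistory H x' t ≤ mΩ := jointHistory_le hx'.measurable ht.le
  have hH : H t ≤ jointHistory H x' t := le_sup_left
  let κ : @Kernel Ω X (jointHistory H x' t) mX :=
    @Kernel.mk Ω X (jointHistory H x' t) mX (fun ω => ν ω)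
      ((@Kernel.measurable Ω X (H t) mX ν).mono hH le_rfl)
  have hκν (ω : Ω) : κ ω = ν ω := rfl
  have hκ : @IsMarkovKernel Ω X (jointHistory H x' t) mX κ :=
    @IsMarkovKernel.mk Ω X (jointHistory H x' t) mX κ
      fun ω => @IsMarkovKernel.isProbabilityMeasure Ω X (H t) mX ν hν ω
  have hpr (ω : Ω) : IsProbabilityMeasure (κ ω) :=
    @IsMarkovKernel.isProbabilityMeasure Ω X (H t) mX ν hν ω
  have hy : Measurable (x (t + 1)) := (hx.adapted t ht).mono (H.le _) le_rfl
  have hy' : Measurable (x' (t + 1)) := hx'.measurable t ht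
  -- Taking one of the two sets to be everything in `cond_iid` yields the marginal laws of `x (t +
  -- 1)` and `x' (t + 1)` given the joint history.
  have hone : P⟦(Set.univ : Set Ω) | H t⟧ = fun _ => (1 : ℝ) := by
    rw [Set.indicator_univ]
    exact condExp_const (H.le t) 1
  have hl₁ (A : Set X) (hA : MeasurableSet A) :
      P⟦x (t + 1) ⁻¹' A | jointHistory H x' t⟧ =ᵐ[P] fun ω => (κ ω).real A := by
    have h := hx'.cond_iid t ht A Set.univ hA MeasurableSet.univ
    simp only [Set.preimage_univ, Set.inter_univ, hone] at h
    filter_upwards [h, hlaw A hA] with ω h1 h2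
    rw [h1, h2, mul_one, hκν]
  have hl₂ (A : Set X) (hA : MeasurableSet A) :
      P⟦x' (t + 1) ⁻¹' A | jointHistory H x' t⟧ =ᵐ[P] fun ω => (κ ω).real A := by
    have h := hx'.cond_iid t ht Set.univ A MeasurableSet.univ hA
    simp only [Set.preimage_univ, Set.univ_inter, hone] at h
    filter_upwards [h, hlaw A hA] with ω h1 h2
    rw [h1, h2, one_mul, hκν]
  have hmeas (A : Set X) (hA : MeasurableSet A) : Measurable[mΩ] fun ω => κ ω A :=
    (@Kernel.measurable_coe Ω X (jointHistory H x' t) mX κ A hA).mono hm le_rfl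
  have hb := (measurable_indicator_le_stopping hτ t).mono hH le_rfl
  -- The base space is `Ω` itself with the coarser σ-algebra of the joint history, and `π` is the
  -- identity.
  have key := lintegral_shiftedWills_step (mΩ' := jointHistory H x' t) hF hne hS μ hl hc hσ.le
    hσ1 P (π := id) (measurable_id'' hm) κ (by
      filter_upwards [hsm] with ω hω
      exact hω.smul_le hσ (p := κ ω)) hy hy'
    (fun D A hD hA => measure_inter_eq_of_condExp hm P (fun ω => κ ω) hy hA (hmeas A hA)
      (hl₁ A hA) hD)
    (fun D A hD hA => measure_inter_eq_of_condExp hm P (fun ω => κ ω) hy' hA (hmeas A hA)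
      (hl₂ A hA) hD)
    (isForm_stoppedExponent hx.adapted hτ l c ht.le) hb
    (fun ω => by by_cases h : t + 1 ≤ τ ω <;> simp [h]) n k
  refine le_trans (le_of_eq ?_) key
  congr 1
  refine lintegral_congr fun ω => ?_
  rw [stoppedExponent, Finset.sum_range_succ]
  rfl

/-- Rounds are removed from the last backwards; each removal adds `k` sample points, which is why
`n` is general in the induction. -/
theorem lintegral_stoppedExponent_le (hF : ∀ f ∈ F, ∀ z, f z ∈ Set.Icc (0 : ℝ) 1)
    (hne : F.Nonempty) (hS : HasMeasurableSuprema F) (μ : Measure X) [IsProbabilityMeasure μ]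
    {a l c σ : ℝ} (hl : 2 * l * (1 + c) = a * gaussianAbsMoment) (hc : a ^ 2 / 2 ≤ 2 * l * c)
    (hσ : 0 < σ) (hσ1 : σ ≤ 1) (P : Measure Ω) [IsProbabilityMeasure P] {H : Filtration ℕ mΩ}
    {x x' : ℕ → Ω → X} {T : ℕ} (hx : IsSmoothProcess P H x T σ μ) (hx' : IsTangent P H x x' T)
    {τ : Ω → ℕ} (hτ : IsStoppingTime H fun ω => (τ ω : WithTop ℕ)) (n k : ℕ) {t : ℕ}
    (ht : t ≤ T) :
    ENNReal.ofReal (1 - (1 - σ) ^ k) ^ t *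
        ∫⁻ ω, shiftedWills μ F a n (stoppedExponent F l c x x' τ t ω) ∂P ≤
      shiftedWills μ F a (n + k * t) 0 := by
  induction t generalizing n with
  | zero => simp [stoppedExponent]
  | succ t ih =>
    rw [pow_succ, mul_assoc]
    refine (mul_le_mul_right (lintegral_stoppedExponent_succ hF hne hS μ hl hc hσ hσ1 P hx hx' hτ
      ht n k) _).trans ((ih (n + k) (Nat.le_of_succ_le ht)).trans (le_of_eq ?_))
    congr 1
    ring

end TangentSequence

/-! ### Numerical constants -/

/-- The floor loses at most `σ ≤ 1` in `σ k`, so the left side is at most `e (δ/T)²`; then `e ≤ 3`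
and `δ ≤ 1/2`, `T ≥ 1`. -/
theorem one_sub_pow_floor_le {σ δ : ℝ} {T : ℕ} (hσ : 0 < σ) (hσ1 : σ ≤ 1) (hT : 1 ≤ T)
    (hδ : 0 < δ) (hδ2 : δ ≤ 1 / 2) :
    (1 - σ) ^ ⌊2 * Real.log (T / δ) / σ⌋₊ ≤ 3 / 4 / T := by
  have hT' : (1 : ℝ) ≤ T := by exact_mod_cast hT
  have hpos : 0 < (T : ℝ) / δ := by positivity
  set k := ⌊2 * Real.log (T / δ) / σ⌋₊ with hk
  have h1 : 2 * Real.log (T / δ) - 1 ≤ σ * k := by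
    have := Nat.lt_floor_add_one (2 * Real.log (T / δ) / σ)
    rw [← hk, div_lt_iff₀ hσ] at this
    nlinarith
  calc (1 - σ) ^ k ≤ Real.exp (-σ) ^ k := by
        refine pow_le_pow_left₀ (by linarith) ?_ k
        linarith [Real.add_one_le_exp (-σ)]
    _ = Real.exp (-(σ * k)) := by rw [← Real.exp_nat_mul]; ring_nf
    _ ≤ Real.exp (1 - Real.log (T / δ) - Real.log (T / δ)) := Real.exp_le_exp.2 (by linarith)
    _ = Real.exp 1 * (δ / T) * (δ / T) := by
        rw [Real.exp_sub, Real.exp_sub, Real.exp_log hpos, div_div, div_eq_mul_inv]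
        field_simp
    _ ≤ 3 * (1 / 2 / T) * (1 / 2 / 1) := by
        have := Real.exp_one_lt_d9
        gcongr
        linarith
    _ = 3 / 4 / T := by ring

/-- Bernoulli's inequality applied to `(1 - 3/(4T))^T`. -/
theorem quarter_le_pow {σ δ : ℝ} {T : ℕ} (hσ : 0 < σ) (hσ1 : σ ≤ 1) (hT : 1 ≤ T)
    (hδ : 0 < δ) (hδ2 : δ ≤ 1 / 2) :
    1 / 4 ≤ (1 - (1 - σ) ^ ⌊2 * Real.log (T / δ) / σ⌋₊) ^ T := by
  have hT' : (1 : ℝ) ≤ T := by exact_mod_cast hT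
  have h1 := one_sub_pow_floor_le hσ hσ1 hT hδ hδ2
  have h2 : 3 / 4 / (T : ℝ) ≤ 3 / 4 := div_le_self (by norm_num) hT'
  have h3 := one_add_mul_le_pow (a := -(3 / 4 / (T : ℝ))) (by linarith) T
  calc (1 : ℝ) / 4 = 1 + T * -(3 / 4 / (T : ℝ)) := by field_simp; norm_num
    _ ≤ _ := h3
    _ ≤ _ := pow_le_pow_left₀ (by linarith) (by linarith) T

/-- The first equation forces `l`, and the penalty condition becomes `a ≤ 2s c'/(1 + c')` with `s =
gaussianAbsMoment ≥ 2/3`. With `c' = c` the last bound would fail for large `c`. Capping at `3` is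
harmless: there `c'/(1 + c') = 3/4`, and `4/3 · 3/4 = 1 > a`. Since `1 + c' ≤ 4`, the constant `36`
gives `18s/4 ≥ 3`. -/
theorem exists_exponent_parameters {c : ℝ} (hc : 0 < c) :
    ∃ l c' : ℝ, 0 < l ∧ c' ≤ c ∧ 2 * l * (1 + c') = c / (1 + c) * gaussianAbsMoment ∧
      (c / (1 + c)) ^ 2 / 2 ≤ 2 * l * c' ∧ 1 ≤ l * (36 * ((1 + c) ^ 2 / c)) ∧
      3 ≤ l * (36 * ((1 + c) ^ 2 / c)) * (1 / c) := by
  set c' := min c 3 with hc'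
  have h0 : 0 < c' := lt_min hc (by norm_num)
  have h1 : c' ≤ c := min_le_left _ _
  have h3 : c' ≤ 3 := min_le_right _ _
  have hs := gaussianAbsMoment_ge
  set s := gaussianAbsMoment with hs'
  refine ⟨c / (1 + c) * s / (2 * (1 + c')), c', by positivity, h1, by field_simp, ?_, ?_, ?_⟩
  · have key : c / (1 + c) ≤ 4 / 3 * (c' / (1 + c')) := by
      rw [← mul_div_assoc, div_le_div_iff₀ (by linarith) (by linarith)]
      rcases min_choice c 3 with h | h
      · rw [hc', h]; nlinarith
      · rw [hc', h]; nlinarith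
    have hq : 0 < c' / (1 + c') := by positivity
    have key2 : c / (1 + c) ≤ 2 * s * (c' / (1 + c')) := key.trans (by gcongr; linarith)
    have ha : 0 < c / (1 + c) := by positivity
    calc (c / (1 + c)) ^ 2 / 2 = (c / (1 + c)) * (c / (1 + c)) / 2 := by ring
      _ ≤ (c / (1 + c)) * (2 * s * (c' / (1 + c'))) / 2 := by gcongr
      _ = _ := by field_simp
  · have e : c / (1 + c) * s / (2 * (1 + c')) * (36 * ((1 + c) ^ 2 / c)) =
        18 * s * (1 + c) / (1 + c') := by field_simp; norm_num
    rw [e, le_div_iff₀ (by linarith)]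
    nlinarith
  · have e : c / (1 + c) * s / (2 * (1 + c')) * (36 * ((1 + c) ^ 2 / c)) * (1 / c) =
        18 * s * (1 + c) / (c * (1 + c')) := by field_simp; norm_num
    rw [e, le_div_iff₀ (by positivity)]
    nlinarith

/-! ### The deviation bound -/

theorem mainTheorem11 :
    ∃ C₀ : ℝ, 1 ≤ C₀ ∧
      ∀ (X : Type*) (_ : MeasurableSpace X) (μ : Measure X) (_ : IsProbabilityMeasure μ)
        (F : Set (X → ℝ)) (_ : F.Nonempty)
        (_ : ∀ f ∈ F, Measurable f ∧ ∀ z, f z ∈ Set.Icc (0 : ℝ) 1)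
        (_ : HasMeasurableSuprema F)
        (Ω : Type*) (mΩ : MeasurableSpace Ω) (P : Measure Ω) (_ : IsProbabilityMeasure P)
        (H : Filtration ℕ mΩ) (T : ℕ) (_ : 1 ≤ T) (σ : ℝ) (_ : 0 < σ)
        (x x' : ℕ → Ω → X) (_ : IsSmoothProcess P H x T σ μ) (_ : IsTangent P H x x' T)
        (τ : Ω → ℕ) (_ : IsStoppingTime H (fun ω => (τ ω : WithTop ℕ))) (_ : ∀ ω, τ ω ≤ T)
        (c : ℝ) (_ : 0 < c) (δ : ℝ) (_ : 0 < δ) (_ : δ ≤ 1 / 2),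
        ENNReal.ofReal (1 - δ) ≤
          P {ω | (⨆ f : F, ∑ t ∈ Finset.Icc 1 (τ ω),
                ((f : X → ℝ) (x' t ω) - (1 + 2 * c) * (f : X → ℝ) (x t ω))) ≤
              C₀ * ((1 + c) ^ 2 / c) *
                (Real.log (expectedWills μ ((c / (1 + c)) • F)
                    ⌊2 * (T : ℝ) * Real.log ((T : ℝ) / δ) / σ⌋₊) +
                  1 / c * Real.log (1 / δ))} := by
  refine ⟨36, by norm_num, ?_⟩
  intro X _ μ _ F hne hF' hS Ω mΩ P _ H T hT σ hσ x x' hx hx' τ hτ hτT c hc δ hδ hδ2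
  have hF : ∀ f ∈ F, ∀ z, f z ∈ Set.Icc (0 : ℝ) 1 := fun f hf => (hF' f hf).2
  have := hne.to_subtype
  -- A probability measure `ν` with `σ ν ≤ μ` exists because there is at least one round; compare
  -- total masses.
  have hσ1 : σ ≤ 1 := by
    obtain ⟨ν, hν, hsm, -⟩ := hx.smooth 0 hT
    obtain ⟨ω, hω⟩ := hsm.exists
    have : IsProbabilityMeasure (ν ω) :=
      @IsMarkovKernel.isProbabilityMeasure Ω X (H 0) _ ν hν ω
    exact hω.le_one hσ
  obtain ⟨l, c', hl0, hc'c, hl, hlc, hb1, hb2⟩ := exists_exponent_parameters hc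
  set a := c / (1 + c) with ha
  set M := ⌊2 * (T : ℝ) * Real.log ((T : ℝ) / δ) / σ⌋₊ with hM
  set k := ⌊2 * Real.log ((T : ℝ) / δ) / σ⌋₊ with hk
  set W := expectedWills μ (a • F) M with hW
  set R := 36 * ((1 + c) ^ 2 / c) * (Real.log W + 1 / c * Real.log (1 / δ)) with hR
  have hT' : (1 : ℝ) ≤ T := by exact_mod_cast hT
  have hW1 : 1 ≤ W := by
    have h := one_le_shiftedWills_zero hF hne hS μ a M
    rw [← ofReal_expectedWills hF hne hS] at h
    exact ENNReal.one_le_ofReal.1 h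
  -- Flooring per round before multiplying by `T` uses no more points than the single floor `M`;
  -- monotonicity in the number of points covers the gap.
  have hkT : k * T ≤ M := by
    refine Nat.le_floor ?_
    have hlog : 0 ≤ Real.log ((T : ℝ) / δ) :=
      Real.log_nonneg ((one_le_div hδ).2 (by linarith))
    have : (k : ℝ) ≤ 2 * Real.log ((T : ℝ) / δ) / σ := Nat.floor_le (by positivity)
    calc ((k * T : ℕ) : ℝ) = k * T := by push_cast; ring
      _ ≤ 2 * Real.log ((T : ℝ) / δ) / σ * T := by gcongr
      _ = _ := by ring
  have hlR : Real.log W + 3 * Real.log (1 / δ) ≤ l * R := by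
    have hlogW : 0 ≤ Real.log W := Real.log_nonneg hW1
    have hlogδ : 0 ≤ Real.log (1 / δ) := Real.log_nonneg ((one_le_div hδ).2 (by linarith))
    calc Real.log W + 3 * Real.log (1 / δ)
        ≤ l * (36 * ((1 + c) ^ 2 / c)) * Real.log W +
          l * (36 * ((1 + c) ^ 2 / c)) * (1 / c) * Real.log (1 / δ) := by
          gcongr
          exact le_mul_of_one_le_left hlogW hb1
      _ = l * R := by rw [hR]; ring
  have hexp : W * (1 / δ) ^ 3 ≤ Real.exp (l * R) := by
    refine le_trans (le_of_eq ?_) (Real.exp_le_exp.2 hlR)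
    rw [Real.exp_add, Real.exp_log (by linarith), ← Real.log_rpow (by positivity),
      Real.exp_log (by positivity)]
    norm_cast
  set v := stoppedExponent F l c' x x' τ T with hv
  have hform : @IsForm X _ F Ω mΩ v := by
    have h := isForm_stoppedExponent (F := F) (x' := x') hx.adapted hτ l c' le_rfl
    exact @IsForm.comp X _ F Ω (jointHistory H x' T) Ω mΩ v h id
      (measurable_id'' (jointHistory_le hx'.measurable le_rfl))
  have hE : ∫⁻ ω, supExp F (v ω) ∂P ≤ ENNReal.ofReal (4 * W) := by
    have h1 := lintegral_stoppedExponent_le hF hne hS μ hl hlc hσ hσ1 P hx hx' hτ 0 k le_rfl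
    have h2 : _ ≤ shiftedWills μ F a M 0 := h1.trans
      (shiftedWills_mono hF hne hS μ a (v := 0) IsForm.zero
      (show 0 + k * T ≤ M by simpa using hkT))
    have h0 : 0 ≤ 1 - (1 - σ) ^ k := sub_nonneg.2 (pow_le_one₀ (by linarith) (by linarith))
    rw [← ofReal_expectedWills hF hne hS, ← hW, ← ENNReal.ofReal_pow h0] at h2
    have h3 : ENNReal.ofReal (1 / 4) * ∫⁻ ω, supExp F (v ω) ∂P ≤ ENNReal.ofReal W :=
      le_trans
        (mul_le_mul' (ENNReal.ofReal_le_ofReal (quarter_le_pow hσ hσ1 hT hδ hδ2)) le_rfl) h2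
    calc ∫⁻ ω, supExp F (v ω) ∂P
        = ENNReal.ofReal 4 * (ENNReal.ofReal (1 / 4) * ∫⁻ ω, supExp F (v ω) ∂P) := by
          rw [← mul_assoc, ← ENNReal.ofReal_mul (by norm_num)]
          norm_num
      _ ≤ ENNReal.ofReal 4 * ENNReal.ofReal W := by gcongr
      _ = _ := (ENNReal.ofReal_mul (by norm_num)).symm
  have hbad : P {ω | ENNReal.ofReal (Real.exp (l * R)) ≤ supExp F (v ω)} ≤ ENNReal.ofReal δ := by
    have hmk := mul_meas_ge_le_lintegral₀ (hform.aemeasurable_supExp hF hne hS P)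
      (ENNReal.ofReal (Real.exp (l * R)))
    refine (ENNReal.mul_le_mul_iff_right (a := ENNReal.ofReal (Real.exp (l * R)))
      (by simp [Real.exp_pos]) ENNReal.ofReal_ne_top).1 (hmk.trans (hE.trans ?_))
    rw [← ENNReal.ofReal_mul (Real.exp_nonneg _)]
    refine ENNReal.ofReal_le_ofReal ?_
    -- Of the three powers of `1/δ` in `hexp`, two absorb the factor `4` from rejection sampling and
    -- the third gives the probability `δ`.
    have h4 : 4 ≤ (1 / δ) ^ 2 := by
      have : (2 : ℝ) ≤ 1 / δ := by rw [le_div_iff₀ hδ]; linarith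
      nlinarith
    calc 4 * W ≤ (1 / δ) ^ 2 * W := by gcongr
      _ = W * (1 / δ) ^ 3 * δ := by field_simp
      _ ≤ _ := by gcongr
  set G := {ω | (⨆ f : F, ∑ t ∈ Finset.Icc 1 (τ ω),
    ((f : X → ℝ) (x' t ω) - (1 + 2 * c) * (f : X → ℝ) (x t ω))) ≤ R} with hG
  -- If the supremum exceeds `R`, some single `f` does; as `f ≥ 0` and `c' ≤ c`, its sum with `c'`
  -- in place of `c` is at least as large.
  have hsub : Gᶜ ⊆ {ω | ENNReal.ofReal (Real.exp (l * R)) ≤ supExp F (v ω)} := by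
    intro ω hω
    have hlt : R < ⨆ f : F, ∑ t ∈ Finset.Icc 1 (τ ω),
        ((f : X → ℝ) (x' t ω) - (1 + 2 * c) * (f : X → ℝ) (x t ω)) := not_le.1 hω
    obtain ⟨f, hf⟩ := exists_lt_of_lt_ciSup hlt
    refine le_trans (ENNReal.ofReal_le_ofReal (Real.exp_le_exp.2 ?_))
      (le_iSup (fun f => ENNReal.ofReal (Real.exp (v ω f))) f)
    have e : v ω f = l * ∑ t ∈ Finset.Icc 1 (τ ω),
        ((f : X → ℝ) (x' t ω) - (1 + 2 * c') * (f : X → ℝ) (x t ω)) := by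
      have hset : Finset.Icc 1 (τ ω) =
          ((Finset.range T).filter fun s => s + 1 ≤ τ ω).image fun s => s + 1 := by
        ext t
        simp only [Finset.mem_Icc, Finset.mem_image, Finset.mem_filter, Finset.mem_range]
        constructor
        · rintro ⟨h1, h2⟩
          exact ⟨t - 1, by have := hτT ω; omega, by omega⟩
        · rintro ⟨s, ⟨-, h2⟩, rfl⟩
          omega
      rw [hset, Finset.sum_image (fun _ _ _ _ h => Nat.succ_injective h), Finset.sum_filter,
        Finset.mul_sum, hv, stoppedExponent, Finset.sum_apply]
      refine Finset.sum_congr rfl fun s _ => ?_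
      split_ifs <;> simp
    rw [e]
    refine mul_le_mul_of_nonneg_left (hf.le.trans (Finset.sum_le_sum fun t _ => ?_)) hl0.le
    have := (hF f f.2 (x t ω)).1
    gcongr
  have hcover : 1 ≤ P G + ENNReal.ofReal δ := by
    calc 1 = P (G ∪ Gᶜ) := by simp
      _ ≤ P G + P Gᶜ := measure_union_le _ _
      _ ≤ _ := by gcongr; exact (measure_mono hsub).trans hbad
  rw [ENNReal.ofReal_sub _ hδ.le, ENNReal.ofReal_one]
  exact tsub_le_iff_right.2 hcover

end
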